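/- Let $q$ be an odd prime power with $q\equiv 3\pmod{10}$, and put $n=\frac{q^2+1}{10}$, $r=q+1$, $s=\frac{q^2+1}{2}$. Let $1\le\lambda\le\frac{q-3}{10}$. Let $\alpha\in\mathbb F_{q^2}^*$ be a primitive $r$-th root of unity and let $\delta$ be a primitive $rn$-th root of unity in an extension field of $\mathbb F_{q^2}$ with $\delta^n=\alpha$. For an integer $i$ let $C_i=\{iq^{2j} \bmod rn : j\in\mathbb Z\}$ be the $q^2$-cyclotomic coset of $i$ modulo $rn$. An $\alpha$-constacyclic code of length $n$ over $\mathbb F_{q^2}$ with monic generator polynomial $g\mid x^n-\alpha$ has defining set $\{i\in\{1+rj \bmod rn: 0\le j\le n-1\}: g(\delta^i)=0\}$. Let $$Z=\bigcup_{j=0}^{\frac{3(q-3)}{10}+\lambda}C_{s-rj},\qquad -qZ=\{-qz \bmod rn: z\in Z\},$$ $$k=n-\tfrac65(q-3)-4\lambda+3,\qquad d=\tfrac35(q-3)+2\lambda+2 .$$ Then: 1. $Z\cap(-qZ)=C_s\cup C_{s-r\frac{3q+1}{10}}\cup C_{s-r\frac{q-3}{10}}$. 2. There is an $\alpha$-constacyclic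 code $\mathcal C$ of length $n$ over $\mathbb F_{q^2}$ with defining set $Z$. Every such $\mathcal C$ has minimum Hamming distance $d$ and dimension $K$ with $2K-n+5=k$, and each parity check matrix $H$ of $\mathcal C$ satisfies $\operatorname{rank}(HH^{*})=5$, where $H^{*}$ is the transpose of the matrix obtained from $H$ by raising all entries to the $q$-th power. 3. There exists an entanglement-assisted quantum error-correcting code with parameters $$[[\,n,\;n-\tfrac65(q-3)-4\lambda+3,\;\tfrac35(q-3)+2\lambda+2;\;5\,]]_q ,$$ that is, an isometry $V:(\mathbb C^q)^{\otimes k}\otimes(\mathbb C^q)^{\otimes 5}\to(\mathbb C^q)^{\otimes n}$, which the sender applies to $k$ information qudits and to her halves of $5$ maximally entangled pairs, the receiver's halves being free of errors, such that $d$ is exactly the least number of transmitted qudits on which an undetectable error acts. It attains equality in the entanglement-assisted Singleton bound, $n+5-k=2(d-1)$, and $d\le\frac{n+2}{2}$ unless $q=13$; thus it is an EAQMDS code (for $q=13$ in the sense of the equality only, where $n=17$ and $d=10$). -/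

import Mathlib

open Polynomial
open scoped Matrix

noncomputable section

namespace EAQ

/-! ### Cyclotomic cosets, constacyclic codes and their defining sets -/

/-- The `q²`-cyclotomic coset of `i` modulo `N`. (When `q` is a unit modulo `N`, nonnegative
exponents give the same set as all integer exponents.) -/
def cyclotomicCoset (q N : ℕ) (i : ZMod N) : Set (ZMod N) :=
  {x | ∃ j : ℕ, x = i * ((q : ZMod N) ^ 2) ^ j}

/-- The set `-qZ` modulo `N`. -/
def negMul (q N : ℕ) (Z : Set (ZMod N)) : Set (ZMod N) :=
  {x | ∃ z ∈ Z, x = -(q : ZMod N) * z}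

/-- The set `O_{rn} = {1 + r j | 0 ≤ j ≤ n - 1}` of exponents of the roots of `X ^ n - α`. -/
def rootExponents (r n : ℕ) : Set (ZMod (r * n)) :=
  {x | ∃ j : ℕ, j < n ∧ x = 1 + (r : ZMod (r * n)) * (j : ZMod (r * n))}

/-- The constacyclic shift `(c₀, …, cₙ₋₁) ↦ (α cₙ₋₁, c₀, …, cₙ₋₂)`. -/
def constaShift {F : Type*} [Field F] {n : ℕ} (α : F) (c : Fin n → F) : Fin n → F :=
  fun i => if (i : ℕ) = 0 then α * c ⟨(n - 1 : ℕ), by have := i.2; omega⟩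
    else c ⟨(i : ℕ) - 1, by have := i.2; omega⟩

/-- A linear code closed under the `α`-constacyclic shift. -/
def IsConstacyclic {F : Type*} [Field F] {n : ℕ} (α : F) (C : Submodule F (Fin n → F)) : Prop :=
  ∀ c ∈ C, constaShift α c ∈ C

/-- The polynomial `c₀ + c₁ X + ⋯ + cₙ₋₁ X ^ (n - 1)` of a word. -/
def wordPoly {F : Type*} [Field F] {n : ℕ} (c : Fin n → F) : F[X] :=
  ∑ i : Fin n, Polynomial.C (c i) * X ^ (i : ℕ)

/-- `g` is the monic divisor of `X ^ n - α` that generates `C`, seen as an ideal of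
`F[X] / (X ^ n - α)`. -/
def IsGeneratorPoly {F : Type*} [Field F] {n : ℕ} (α : F) (C : Submodule F (Fin n → F))
    (g : F[X]) : Prop :=
  g.Monic ∧ g ∣ X ^ n - Polynomial.C α ∧
    ∀ c : Fin n → F, c ∈ C ↔
      Ideal.Quotient.mk (Ideal.span {X ^ n - Polynomial.C α}) (wordPoly c) ∈
        Ideal.span {Ideal.Quotient.mk (Ideal.span {X ^ n - Polynomial.C α}) g}

/-- The exponents `i ∈ O_{rn}` for which `δ ^ i` is a root of `g`. -/
def rootSet {F K : Type*} [Field F] [Field K] [Algebra F K] (r n : ℕ) (δ : K) (g : F[X]) :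
    Set (ZMod (r * n)) :=
  {i | i ∈ rootExponents r n ∧ Polynomial.aeval (δ ^ i.val) g = 0}

/-- `C` is an `α`-constacyclic code of length `n` with defining set `Z` with respect to the
`rn`-th root of unity `δ`. -/
def IsConstacyclicWithDefiningSet {F K : Type*} [Field F] [Field K] [Algebra F K] (r n : ℕ)
    (δ : K) (α : F) (C : Submodule F (Fin n → F)) (Z : Set (ZMod (r * n))) : Prop :=
  IsConstacyclic α C ∧ ∃ g : F[X], IsGeneratorPoly α C g ∧ rootSet r n δ g = Z

/-- `C` has minimum Hamming distance exactly `d`. -/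
def HasMinDist {F : Type*} [Field F] [DecidableEq F] {n : ℕ} (C : Submodule F (Fin n → F))
    (d : ℕ) : Prop :=
  IsLeast {w | ∃ c ∈ C, c ≠ 0 ∧ hammingNorm c = w} d

/-- `H` is a parity check matrix of `C`. -/
def IsParityCheck {F : Type*} [Field F] {m n : ℕ} (H : Matrix (Fin m) (Fin n) F)
    (C : Submodule F (Fin n → F)) : Prop :=
  LinearIndependent F H.row ∧ ∀ c : Fin n → F, c ∈ C ↔ H *ᵥ c = 0

/-- The conjugate transpose over the field with `q²` elements, for the conjugation `x ↦ x ^ q`. -/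
def conjTransposeQ {F : Type*} [Field F] {m n : ℕ} (q : ℕ) (H : Matrix (Fin m) (Fin n) F) :
    Matrix (Fin n) (Fin m) F :=
  (H.map (fun x => x ^ q))ᵀ

/-! ### Entanglement-assisted quantum error-correcting codes

A register of `n` qudits has the computational basis `Fin n → Fin q`; its state vectors are the
functions `(Fin n → Fin q) → ℂ`. -/

/-- The basis labels of `n` qudits of dimension `q`. -/
abbrev Labels (q n : ℕ) : Type := Fin n → Fin q

/-- `c` maximally entangled pairs of qudits, `q ^ (-c/2) ∑_b |b⟩ ⊗ |b⟩`; the first half belongs to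
the sender, the second half to the receiver. -/
def ebits (q c : ℕ) (p : Labels q c × Labels q c) : ℂ :=
  if p.1 = p.2 then ((Real.sqrt ((q : ℝ) ^ c) : ℝ) : ℂ)⁻¹ else 0

/-- The encoded state `(V ⊗ I) (ψ ⊗ ebits)`: the sender applies `V` to `k` information qudits and
to her halves of the `c` entangled pairs, the receiver's halves are untouched. -/
def encode {q n k c : ℕ} (V : Matrix (Labels q n) (Labels q k × Labels q c) ℂ)
    (ψ : Labels q k → ℂ) : Labels q n × Labels q c → ℂ :=
  fun p => ∑ x : Labels q k, ∑ b : Labels q c, V p.1 (x, b) * (ψ x * ebits q c (b, p.2))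

/-- `E ⊗ I` for an operator `E` on the `n` transmitted qudits. -/
def applyError {q n c : ℕ} (E : Matrix (Labels q n) (Labels q n) ℂ)
    (v : Labels q n × Labels q c → ℂ) : Labels q n × Labels q c → ℂ :=
  fun p => ∑ a : Labels q n, E p.1 a * v (a, p.2)

/-- `E` is of the form `M ⊗ I` with `M` an operator on the qudits in `S`. -/
def ActsOn {q n : ℕ} (E : Matrix (Labels q n) (Labels q n) ℂ) (S : Finset (Fin n)) : Prop :=
  ∃ M : Matrix (S → Fin q) (S → Fin q) ℂ, ∀ a a' : Labels q n,
    E a a' = if ∀ i : Fin n, i ∉ S → a i = a' i then M (fun i => a i) (fun i => a' i) else 0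

/-- The Knill–Laflamme condition: `P (E ⊗ I) P = μ P` for the projection `P` onto the space of
encoded states. -/
def Detects {q n k c : ℕ} (V : Matrix (Labels q n) (Labels q k × Labels q c) ℂ)
    (E : Matrix (Labels q n) (Labels q n) ℂ) : Prop :=
  ∃ μ : ℂ, ∀ φ ψ : Labels q k → ℂ,
    star (encode V φ) ⬝ᵥ applyError E (encode V ψ) = μ * (star (encode V φ) ⬝ᵥ encode V ψ)

/-- `V` encodes an entanglement-assisted quantum code with parameters `⟦n, k, d; c⟧_q`: it is an
isometry (a unitary on `n` qudits, of which `n - k - c` start as ancillas in a fixed state), and `d`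
is the minimum distance, that is the least number of transmitted qudits on which some undetectable
error acts. The receiver's halves of the entangled pairs are free of errors. -/
structure IsEAQECC (q n k d c : ℕ) (V : Matrix (Labels q n) (Labels q k × Labels q c) ℂ) :
    Prop where
  isometry : Vᴴ * V = 1
  minDist : IsLeast {w | ∃ (S : Finset (Fin n)) (E : Matrix (Labels q n) (Labels q n) ℂ),
    S.card = w ∧ ActsOn E S ∧ ¬ Detects V E} d

/-- There is an entanglement-assisted quantum code with parameters `⟦n, k, d; c⟧_q`. -/
def ExistsEAQECC (q n k d c : ℕ) : Prop :=
  ∃ V : Matrix (Labels q n) (Labels q k × Labels q c) ℂ, IsEAQECC q n k d c V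

end EAQ

end

/-!
Write the exponents as `s + r j` with `j` modulo `n`. Multiplication by `q ^ 2` is the reflection
`j ↦ -j`, so `Z` is the interval `|j| ≤ b` with `b = 3 (q - 3) / 10 + l`. The roots are thus
consecutive, and the BCH bound makes the code MDS. Multiplication by `-q` is `j ↦ -q j`, which sends
exactly five points of the interval back into it.

The rank of `H Hᴴ` is the size of `Z ∩ -q Z`: over the field containing `δ`, the rows of `H` may be
replaced by the geometric progressions of the `δ ^ i`, `i ∈ Z`, whose Hermitian Gram matrix is a
partial permutation matrix by orthogonality of characters.

For the quantum code, the errors form a Weyl system over the symplectic space of the Hermitian form.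
Modulo its radical, the Hermitian dual of a code `C` has an orthonormal basis of `c = rank (H Hᴴ)`
vectors, and `C` has one of `k` vectors; with the radical as stabilizer, these two families carry
the Weyl operators of the ebits and of the information qudits. An isometry intertwining the two Weyl
systems is the encoder, and it fails to detect exactly the errors in `C` outside the radical. As `C`
is spanned by its words of least weight, one of them lies outside the radical, so the quantum
distance is the Hamming distance.
-/

noncomputable section

namespace EAQ

/-! ### Weyl systems -/

/-- The pairing `β ^ 2` given by a bicharacter `β` is symplectic (alternating and nondegenerate).
The square root `β` is kept because it is the cocycle of the Weyl operators, while `β ^ 2` is their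
commutator. -/
structure IsSymplectic {G : Type*} [AddCommGroup G] (β : AddChar G (AddChar G ℂ)) : Prop where
  self (e : G) : β e e = 1
  nondegenerate (e : G) : e ≠ 0 → ∃ f, β e f ^ 2 ≠ 1

/-- `W` is a projective unitary representation of `G` with cocycle `β`: a system of Weyl
(generalized Pauli) operators. -/
structure IsWeylSystem {G L : Type*} [AddCommGroup G] [Fintype L] [DecidableEq L]
    (β : AddChar G (AddChar G ℂ)) (W : G → Matrix L L ℂ) : Prop where
  zero : W 0 = 1
  mul (e f : G) : W e * W f = β e f • W (e + f)
  conjTranspose (e : G) : (W e)ᴴ = W (-e)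

section Bicharacter

variable {G : Type*} [AddCommGroup G] {β : AddChar G (AddChar G ℂ)}

theorem IsSymplectic.mul_swap (hβ : IsSymplectic β) (e f : G) : β e f * β f e = 1 := by
  simpa [AddChar.map_add_eq_mul, hβ.self, mul_comm] using hβ.self (e + f)

theorem bicharacter_neg_left (e f : G) : β (-e) f = (β e f)⁻¹ := by
  refine eq_inv_of_mul_eq_one_left ?_
  rw [← AddChar.mul_apply, ← AddChar.map_add_eq_mul, neg_add_cancel, AddChar.map_zero_eq_one,
    AddChar.one_apply]

theorem IsSymplectic.neg_left (hβ : IsSymplectic β) (e f : G) : β (-e) f = β f e := by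
  rw [bicharacter_neg_left, inv_eq_of_mul_eq_one_right (hβ.mul_swap e f)]

theorem IsSymplectic.self_neg (hβ : IsSymplectic β) (e : G) : β e (-e) = 1 := by
  simpa only [neg_neg, hβ.self] using hβ.neg_left (-e) (-e)

end Bicharacter

section WeylSystem

variable {G L : Type*} [AddCommGroup G] [Fintype L] [DecidableEq L]
  {β : AddChar G (AddChar G ℂ)} {W : G → Matrix L L ℂ}

theorem IsWeylSystem.mul_neg (hβ : IsSymplectic β) (hW : IsWeylSystem β W) (e : G) :
    W e * W (-e) = 1 := by
  rw [hW.mul, hβ.self_neg, add_neg_cancel, hW.zero, one_smul]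

theorem IsWeylSystem.neg_mul (hβ : IsSymplectic β) (hW : IsWeylSystem β W) (e : G) :
    W (-e) * W e = 1 := by
  simpa using hW.mul_neg hβ (-e)

theorem IsWeylSystem.mul_comm (hβ : IsSymplectic β) (hW : IsWeylSystem β W) (e f : G) :
    W e * W f = β e f ^ 2 • (W f * W e) := by
  rw [hW.mul, hW.mul, smul_smul, sq, mul_assoc, hβ.mul_swap, mul_one, add_comm]

theorem IsWeylSystem.trace_eq_zero (hβ : IsSymplectic β) (hW : IsWeylSystem β W) {e : G}
    (he : e ≠ 0) : (W e).trace = 0 := by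
  obtain ⟨f, hf⟩ := hβ.nondegenerate e he
  have h : (W e).trace = β e f ^ 2 * (W e).trace :=
    calc (W e).trace = (W e * W f * W (-f)).trace := by
          rw [mul_assoc, hW.mul_neg hβ, mul_one]
      _ = β e f ^ 2 * (W f * W e * W (-f)).trace := by
          rw [hW.mul_comm hβ, Matrix.smul_mul, Matrix.trace_smul, smul_eq_mul]
      _ = β e f ^ 2 * (W e).trace := by
          rw [Matrix.trace_mul_comm, ← mul_assoc, hW.neg_mul hβ, one_mul]
  by_contra h0
  exact hf (mul_right_cancel₀ h0 (by rw [← h, one_mul]))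

theorem IsWeylSystem.linearIndependent [Finite G] [Nonempty L] (hβ : IsSymplectic β)
    (hW : IsWeylSystem β W) : LinearIndependent ℂ W := by
  have := Fintype.ofFinite G
  rw [Fintype.linearIndependent_iff]
  intro g hg e
  have h : (W (-e) * ∑ f, g f • W f).trace = g e * Fintype.card L := by
    rw [Finset.mul_sum, Matrix.trace_sum, Finset.sum_eq_single e]
    · rw [Matrix.mul_smul, hW.neg_mul hβ, Matrix.trace_smul, Matrix.trace_one, smul_eq_mul]
    · intro f _ hf
      rw [Matrix.mul_smul, hW.mul, Matrix.trace_smul, Matrix.trace_smul,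
        hW.trace_eq_zero hβ fun h0 => hf (neg_add_eq_zero.1 h0).symm, smul_zero, smul_zero]
    · simp
  rw [hg, mul_zero, Matrix.trace_zero, eq_comm, mul_eq_zero] at h
  exact h.resolve_right (by exact_mod_cast Fintype.card_ne_zero)

theorem IsWeylSystem.eq_zero_of_eq_smul_one [Finite G] [Nonempty L] (hβ : IsSymplectic β)
    (hW : IsWeylSystem β W) {e : G} {z : ℂ} (h : W e = z • 1) : e = 0 := by
  by_contra he
  have htrace := hW.trace_eq_zero hβ he
  rw [h, Matrix.trace_smul, Matrix.trace_one, smul_eq_mul, mul_eq_zero, Nat.cast_eq_zero] at htrace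
  have hz : W e = 0 := by rw [h, htrace.resolve_right Fintype.card_ne_zero, zero_smul]
  exact (hW.linearIndependent hβ).ne_zero e hz

theorem IsWeylSystem.span_eq_top [Finite G] [Nonempty L] (hβ : IsSymplectic β)
    (hW : IsWeylSystem β W) (hcard : Nat.card G = Fintype.card L ^ 2) :
    Submodule.span ℂ (Set.range W) = ⊤ := by
  have := Fintype.ofFinite G
  refine (hW.linearIndependent hβ).span_eq_top_of_card_eq_finrank' ?_
  rw [← Nat.card_eq_fintype_card, hcard, Module.finrank_matrix, Module.finrank_self, mul_one, sq]

theorem IsWeylSystem.exists_eq_smul_one [Finite G] [Nonempty L] (hβ : IsSymplectic β)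
    (hW : IsWeylSystem β W) (hcard : Nat.card G = Fintype.card L ^ 2) {M : Matrix L L ℂ}
    (hM : ∀ e, Commute M (W e)) : ∃ z : ℂ, M = z • 1 := by
  have hcomm (N : Matrix L L ℂ) : Commute M N := by
    have hN : N ∈ Submodule.span ℂ (Set.range W) := by
      rw [hW.span_eq_top hβ hcard]; exact Submodule.mem_top
    induction hN using Submodule.span_induction with
    | mem x hx => obtain ⟨e, rfl⟩ := hx; exact hM e
    | zero => exact Commute.zero_right M
    | add x y _ _ hx hy => exact hx.add_right hy
    | smul a x _ hx => exact hx.smul_right a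
  obtain ⟨z, rfl⟩ := Matrix.mem_range_scalar_iff_commute_single'.2 fun i j => (hcomm _).symm
  exact ⟨z, (Matrix.smul_one_eq_diagonal z).symm⟩

end WeylSystem

section Intertwiner

open scoped ComplexOrder in
theorem exists_smul_isometry {L L' : Type*} [Fintype L] [DecidableEq L'] {V : Matrix L L' ℂ}
    {z : ℂ} (hV : V ≠ 0) (hz : Vᴴ * V = z • 1) : ∃ w : ℂ, (w • V)ᴴ * (w • V) = 1 := by
  obtain ⟨b, hb⟩ : ∃ b, (fun a => V a b) ≠ 0 := by
    by_contra! h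
    exact hV (Matrix.ext fun a b => congrFun (h b) a)
  have hzb : star (fun a => V a b) ⬝ᵥ (fun a => V a b) = z := by
    simpa [Matrix.mul_apply, dotProduct] using congrFun (congrFun hz b) b
  have hz0 : 0 < z := hzb ▸ Matrix.dotProduct_star_self_pos_iff.2 hb
  obtain ⟨t, ht, rfl⟩ : ∃ t : ℝ, 0 < t ∧ (t : ℂ) = z := RCLike.pos_iff_exists_ofReal.1 hz0
  refine ⟨((√t)⁻¹ : ℝ), ?_⟩
  rw [Matrix.conjTranspose_smul, Matrix.smul_mul, Matrix.mul_smul, hz, smul_smul, smul_smul,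
    Complex.star_def, Complex.conj_ofReal, ← Complex.ofReal_mul,
    ← Complex.ofReal_mul, ← mul_inv, Real.mul_self_sqrt ht.le, inv_mul_cancel₀ ht.ne',
    Complex.ofReal_one, one_smul]

variable {P G G' L L' : Type*} [AddCommGroup P] [AddCommGroup G] [AddCommGroup G'] [Fintype L]
  [DecidableEq L] [Fintype L'] [DecidableEq L'] {β : AddChar G (AddChar G ℂ)}
  {β' : AddChar G' (AddChar G' ℂ)} {W : G → Matrix L L ℂ} {W' : G' → Matrix L' L' ℂ}

/-- The (unnormalized) average of `X` over `P`, which acts on the rows through `W` and on the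
columns through `W'`. It intertwines the two actions. -/
def twirl [Fintype P] (W : G → Matrix L L ℂ) (W' : G' → Matrix L' L' ℂ) (a : P →+ G) (b : P →+ G')
    (X : Matrix L L' ℂ) : Matrix L L' ℂ :=
  ∑ p, W (a p) * X * W' (-b p)

theorem mul_twirl [Fintype P] (hβ' : IsSymplectic β') (hW : IsWeylSystem β W)
    (hW' : IsWeylSystem β' W') {a : P →+ G} {b : P →+ G'}
    (hab : ∀ p p', β (a p) (a p') = β' (b p) (b p')) (X : Matrix L L' ℂ) (p : P) :
    W (a p) * twirl W W' a b X = twirl W W' a b X * W' (b p) := by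
  simp only [twirl, Matrix.mul_sum, Matrix.sum_mul]
  refine Fintype.sum_equiv (Equiv.addLeft p) _ _ fun p' => ?_
  have hleft : W (a p) * (W (a p') * X * W' (-b p')) =
      β' (b p) (b p') • (W (a (p + p')) * X * W' (-b p')) := by
    rw [← Matrix.mul_assoc, ← Matrix.mul_assoc, hW.mul, Matrix.smul_mul, Matrix.smul_mul, hab,
      map_add]
  have hright : W' (-b (p + p')) * W' (b p) = β' (b p) (b p') • W' (-b p') := by
    rw [hW'.mul, hβ'.neg_left, map_add, AddChar.map_add_eq_mul, hβ'.self, one_mul]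
    congr 2; abel
  rw [hleft, Equiv.coe_addLeft, Matrix.mul_assoc _ _ (W' (b p)), hright, Matrix.mul_smul]

theorem exists_twirl_ne_zero [Fintype P] [Nonempty L] [Nonempty L'] [Finite G] (hβ : IsSymplectic β)
    (hW : IsWeylSystem β W) (hW' : IsWeylSystem β' W') {a : P →+ G} (b : P →+ G')
    (ha : Function.Injective a) : ∃ X, twirl W W' a b X ≠ 0 := by
  by_contra! h
  obtain ⟨j⟩ := ‹Nonempty L'›
  have hli := (hW.linearIndependent hβ).comp a ha
  have hentry (p : P) : W' (-b p) j j = 0 := by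
    refine Fintype.linearIndependent_iff.1 hli (fun p => W' (-b p) j j) ?_ p
    ext i i'
    have h0 := congrFun (congrFun (h (Matrix.single i' j 1)) i) j
    rw [twirl, Matrix.zero_apply, Matrix.sum_apply] at h0
    rw [Matrix.zero_apply, Matrix.sum_apply, ← h0]
    refine Finset.sum_congr rfl fun p _ => ?_
    rw [Matrix.mul_assoc, Matrix.mul_apply, Finset.sum_eq_single i']
    · simp [mul_comm]
    · intro c _ hc; rw [Matrix.single_mul_apply_of_ne _ _ _ _ _ hc, mul_zero]
    · simp
  have h1 := hentry 0
  rw [map_zero, neg_zero, hW'.zero, Matrix.one_apply_eq] at h1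
  exact one_ne_zero h1

theorem exists_isometry [Finite P] [Finite G] [Finite G'] [Nonempty L] [Nonempty L']
    (hβ : IsSymplectic β) (hβ' : IsSymplectic β') (hW : IsWeylSystem β W) (hW' : IsWeylSystem β' W')
    (hcard : Nat.card G' = Fintype.card L' ^ 2) {a : P →+ G} {b : P →+ G'}
    (ha : Function.Injective a) (hb : Function.Surjective b)
    (hab : ∀ p p', β (a p) (a p') = β' (b p) (b p')) :
    ∃ V : Matrix L L' ℂ, Vᴴ * V = 1 ∧ ∀ p, W (a p) * V = V * W' (b p) := by
  have := Fintype.ofFinite P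
  obtain ⟨X, hX⟩ := exists_twirl_ne_zero hβ hW hW' b ha
  have hV := mul_twirl hβ' hW hW' hab X
  set V := twirl W W' a b X
  have hVH (p : P) : Vᴴ * W (a p) = W' (b p) * Vᴴ := by
    simpa only [Matrix.conjTranspose_mul, hW.conjTranspose, hW'.conjTranspose, map_neg, neg_neg]
      using congrArg Matrix.conjTranspose (hV (-p))
  obtain ⟨z, hz⟩ := hW'.exists_eq_smul_one (M := Vᴴ * V) hβ' hcard fun e => by
    obtain ⟨p, rfl⟩ := hb e
    rw [Commute, SemiconjBy, Matrix.mul_assoc, ← hV, ← Matrix.mul_assoc, hVH, Matrix.mul_assoc]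
  obtain ⟨w, hw⟩ := exists_smul_isometry hX hz
  exact ⟨w • V, hw, fun p => by rw [Matrix.mul_smul, Matrix.smul_mul, hV]⟩

end Intertwiner

/-! ### Products of Weyl systems -/

section PiKronecker

variable {ι L : Type*} [Fintype ι]

/-- The Kronecker product of a finite family of matrices with the same index type. -/
def piKronecker (A : ι → Matrix L L ℂ) : Matrix (ι → L) (ι → L) ℂ :=
  Matrix.of fun a b => ∏ i, A i (a i) (b i)

theorem piKronecker_one [DecidableEq L] : piKronecker (1 : ι → Matrix L L ℂ) = 1 := by
  ext a b
  simp [piKronecker, Matrix.one_apply, Finset.prod_ite_zero, funext_iff]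

theorem piKronecker_mul [Fintype L] [DecidableEq ι] (A B : ι → Matrix L L ℂ) :
    piKronecker A * piKronecker B = piKronecker (A * B) := by
  ext a b
  simp only [piKronecker, Matrix.mul_apply, Matrix.of_apply, Pi.mul_apply,
    ← Finset.prod_mul_distrib]
  rw [Finset.prod_univ_sum, Fintype.piFinset_univ]

theorem piKronecker_smul (z : ι → ℂ) (A : ι → Matrix L L ℂ) :
    piKronecker (fun i => z i • A i) = (∏ i, z i) • piKronecker A := by
  ext a b
  simp [piKronecker, Finset.prod_mul_distrib]

theorem conjTranspose_piKronecker (A : ι → Matrix L L ℂ) :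
    (piKronecker A)ᴴ = piKronecker fun i => (A i)ᴴ := by
  ext a b
  simp [piKronecker]

end PiKronecker

section Pi

variable {ι H L : Type*} [Fintype ι] [AddCommGroup H] {β : AddChar H (AddChar H ℂ)}

/-- The bicharacter on `ι → H` whose value is the product of the values of `β` over the
coordinates. -/
def piBicharacter (ι : Type*) [Fintype ι] (β : AddChar H (AddChar H ℂ)) :
    AddChar (ι → H) (AddChar (ι → H) ℂ) where
  toFun e :=
    { toFun := fun f => ∏ i, β (e i) (f i)
      map_zero_eq_one' := by simp
      map_add_eq_mul' := fun f g => by simp [AddChar.map_add_eq_mul, Finset.prod_mul_distrib] }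
  map_zero_eq_one' := by ext f; simp
  map_add_eq_mul' e e' := by
    ext f; simp [AddChar.map_add_eq_mul, Finset.prod_mul_distrib]

theorem piBicharacter_apply (e f : ι → H) : piBicharacter ι β e f = ∏ i, β (e i) (f i) := rfl

theorem IsSymplectic.pi (hβ : IsSymplectic β) : IsSymplectic (piBicharacter ι β) where
  self e := by simp [piBicharacter_apply, hβ.self]
  nondegenerate e he := by
    classical
    obtain ⟨i, hi⟩ := Function.ne_iff.1 he
    obtain ⟨x, hx⟩ := hβ.nondegenerate (e i) hi
    refine ⟨Pi.single i x, ?_⟩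
    rw [piBicharacter_apply, Fintype.prod_eq_single i]
    · simpa using hx
    · intro j hj; simp [hj]

/-- The Weyl operators of a register, as Kronecker products of those of its qudits. -/
def weylOp (w : H → Matrix L L ℂ) (e : ι → H) : Matrix (ι → L) (ι → L) ℂ :=
  piKronecker fun i => w (e i)

theorem IsWeylSystem.pi [DecidableEq ι] [Fintype L] [DecidableEq L] {w : H → Matrix L L ℂ}
    (hw : IsWeylSystem β w) : IsWeylSystem (piBicharacter ι β) (weylOp w) where
  zero := by
    simp only [weylOp, Pi.zero_apply, hw.zero]
    exact piKronecker_one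
  mul e f := by
    rw [weylOp, weylOp, piKronecker_mul, piBicharacter_apply, weylOp, ← piKronecker_smul]
    exact congrArg piKronecker (funext fun i => hw.mul (e i) (f i))
  conjTranspose e := by
    rw [weylOp, conjTranspose_piKronecker]
    exact congrArg piKronecker (funext fun i => hw.conjTranspose (e i))

end Pi

section Prod

variable {G G' L L' : Type*} [AddCommGroup G] [AddCommGroup G'] {β : AddChar G (AddChar G ℂ)}
  {β' : AddChar G' (AddChar G' ℂ)}

/-- The bicharacter on `G × G'` whose value is the product of the values of `β` and `β'`. -/
def prodBicharacter (β : AddChar G (AddChar G ℂ)) (β' : AddChar G' (AddChar G' ℂ)) :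
    AddChar (G × G') (AddChar (G × G') ℂ) where
  toFun e :=
    { toFun := fun f => β e.1 f.1 * β' e.2 f.2
      map_zero_eq_one' := by simp
      map_add_eq_mul' := fun f g => by simp [AddChar.map_add_eq_mul, mul_mul_mul_comm] }
  map_zero_eq_one' := by ext f; simp
  map_add_eq_mul' e e' := by
    ext f; simp [AddChar.map_add_eq_mul, mul_mul_mul_comm]

theorem prodBicharacter_apply (e f : G × G') :
    prodBicharacter β β' e f = β e.1 f.1 * β' e.2 f.2 := rfl

theorem IsSymplectic.prod (hβ : IsSymplectic β) (hβ' : IsSymplectic β') :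
    IsSymplectic (prodBicharacter β β') where
  self e := by rw [prodBicharacter_apply, hβ.self, hβ'.self, one_mul]
  nondegenerate e he := by
    by_cases h : e.1 = 0
    · obtain ⟨f, hf⟩ := hβ'.nondegenerate e.2 fun h' => he (Prod.ext h h')
      exact ⟨(0, f), by simpa [prodBicharacter_apply] using hf⟩
    · obtain ⟨f, hf⟩ := hβ.nondegenerate e.1 h
      exact ⟨(f, 0), by simpa [prodBicharacter_apply] using hf⟩

open scoped Kronecker in
theorem IsWeylSystem.prod [Fintype L] [DecidableEq L] [Fintype L'] [DecidableEq L']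
    {W : G → Matrix L L ℂ} {W' : G' → Matrix L' L' ℂ} (hW : IsWeylSystem β W)
    (hW' : IsWeylSystem β' W') :
    IsWeylSystem (prodBicharacter β β') fun e => W e.1 ⊗ₖ W' e.2 where
  zero := by rw [Prod.fst_zero, Prod.snd_zero, hW.zero, hW'.zero, Matrix.one_kronecker_one]
  mul e f := by
    rw [← Matrix.mul_kronecker_mul, hW.mul, hW'.mul, Matrix.smul_kronecker,
      Matrix.kronecker_smul, smul_smul, prodBicharacter_apply, Prod.fst_add, Prod.snd_add]
  conjTranspose e := by
    rw [Matrix.conjTranspose_kronecker, hW.conjTranspose, hW'.conjTranspose, Prod.fst_neg,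
      Prod.snd_neg]

end Prod

/-! ### Errors acting on some of the qudits -/

section Local

variable {q n : ℕ}

/-- The operator `M ⊗ I` on `n` qudits given by an operator `M` on the qudits in `S`. -/
def extendOp (S : Finset (Fin n)) :
    Matrix (S → Fin q) (S → Fin q) ℂ →ₗ[ℂ] Matrix (Labels q n) (Labels q n) ℂ where
  toFun M := Matrix.of fun a a' =>
    if ∀ i, i ∉ S → a i = a' i then M (fun i => a i) (fun i => a' i) else 0
  map_add' M N := by
    ext a a'; simp only [Matrix.add_apply, Matrix.of_apply]; split_ifs <;> simp
  map_smul' z M := by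
    ext a a'; simp only [Matrix.smul_apply, Matrix.of_apply, RingHom.id_apply]; split_ifs <;> simp

theorem actsOn_iff_mem_range {S : Finset (Fin n)} {E : Matrix (Labels q n) (Labels q n) ℂ} :
    ActsOn E S ↔ E ∈ LinearMap.range (extendOp (q := q) S) :=
  ⟨fun ⟨M, hM⟩ => ⟨M, Matrix.ext fun a a' => (hM a a').symm⟩,
    fun ⟨M, hM⟩ => ⟨M, fun _ _ => hM ▸ rfl⟩⟩

theorem piKronecker_eq_extendOp {S : Finset (Fin n)} {A : Fin n → Matrix (Fin q) (Fin q) ℂ}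
    (hA : ∀ i ∉ S, A i = 1) : piKronecker A = extendOp S (piKronecker fun i : S => A i) := by
  ext a a'
  simp only [piKronecker, extendOp, LinearMap.coe_mk, AddHom.coe_mk, Matrix.of_apply]
  have hcompl : ∏ i ∈ Sᶜ, A i (a i) (a' i) = if ∀ i ∉ S, a i = a' i then 1 else 0 := by
    rw [Finset.prod_congr rfl fun i hi => by rw [hA i (Finset.mem_compl.1 hi), Matrix.one_apply],
      Finset.prod_ite_zero, Finset.prod_const_one]
    simp only [Finset.mem_compl]
  rw [← Finset.prod_mul_prod_compl S, hcompl, ← Finset.prod_coe_sort S, mul_ite, mul_one, mul_zero]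

variable {H : Type*} [AddCommGroup H] {β : AddChar H (AddChar H ℂ)}
  {w : H → Matrix (Fin q) (Fin q) ℂ}

theorem IsWeylSystem.actsOn_weylOp (hw : IsWeylSystem β w) {S : Finset (Fin n)}
    {e : Fin n → H} (he : ∀ i ∉ S, e i = 0) : ActsOn (weylOp w e) S :=
  actsOn_iff_mem_range.2 ⟨_, (piKronecker_eq_extendOp fun i hi => by rw [he i hi, hw.zero]).symm⟩

theorem ActsOn.mem_span [Finite H] [NeZero q] (hβ : IsSymplectic β)
    (hw : IsWeylSystem β w) (hcard : Nat.card H = q ^ 2) {S : Finset (Fin n)}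
    {E : Matrix (Labels q n) (Labels q n) ℂ} (hE : ActsOn E S) :
    E ∈ Submodule.span ℂ (weylOp w '' {e | ∀ i ∉ S, e i = 0}) := by
  obtain ⟨M, rfl⟩ := actsOn_iff_mem_range.1 hE
  have hM : M ∈ Submodule.span ℂ (Set.range (weylOp (ι := S) w)) := by
    rw [hw.pi.span_eq_top hβ.pi]
    · exact Submodule.mem_top
    · simp [Nat.card_fun, hcard, ← pow_mul, mul_comm]
  have hmap := Submodule.mem_map_of_mem (f := extendOp S) hM
  rw [Submodule.map_span] at hmap
  refine Submodule.span_mono ?_ hmap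
  rintro _ ⟨_, ⟨e, rfl⟩, rfl⟩
  refine ⟨fun i => if h : i ∈ S then e ⟨i, h⟩ else 0, fun i hi => dif_neg hi, ?_⟩
  rw [weylOp, piKronecker_eq_extendOp (S := S) fun i hi => by rw [dif_neg hi, hw.zero]]
  simp [weylOp]

end Local

/-! ### Entanglement-assisted codes from Weyl systems -/

section PartialTrace

variable {X Y : Type*} [Fintype Y]

/-- The partial trace over the second factor. -/
def partialTrace : Matrix (X × Y) (X × Y) ℂ →ₗ[ℂ] Matrix X X ℂ where
  toFun A := Matrix.of fun x x' => ∑ y, A (x, y) (x', y)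
  map_add' A B := by ext; simp [Finset.sum_add_distrib]
  map_smul' z A := by ext; simp [Finset.mul_sum]

theorem partialTrace_apply (A : Matrix (X × Y) (X × Y) ℂ) (x x' : X) :
    partialTrace A x x' = ∑ y, A (x, y) (x', y) := rfl

open scoped Kronecker

theorem partialTrace_kronecker (A : Matrix X X ℂ) (B : Matrix Y Y ℂ) :
    partialTrace (A ⊗ₖ B) = B.trace • A := by
  ext x x'
  simp [partialTrace_apply, Matrix.trace, Matrix.kroneckerMap_apply, ← Finset.mul_sum, mul_comm]

theorem partialTrace_one [DecidableEq X] [DecidableEq Y] :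
    partialTrace (1 : Matrix (X × Y) (X × Y) ℂ) = (Fintype.card Y : ℂ) • 1 := by
  rw [← Matrix.one_kronecker_one, partialTrace_kronecker, Matrix.trace_one]

theorem partialTrace_mul_comm [Fintype X] [DecidableEq X] (N : Matrix (X × Y) (X × Y) ℂ)
    (U : Matrix Y Y ℂ) :
    partialTrace ((1 : Matrix X X ℂ) ⊗ₖ U * N) = partialTrace (N * (1 : Matrix X X ℂ) ⊗ₖ U) := by
  ext x x'
  simp only [partialTrace_apply, Matrix.mul_apply, Fintype.sum_prod_type,
    Matrix.kroneckerMap_apply, Matrix.one_apply, ite_mul, mul_ite, one_mul, zero_mul, mul_zero]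
  have hleft (b : Y) : ∑ y, ∑ c, (if x = y then U b c * N (y, c) (x', b) else 0) =
      ∑ c, U b c * N (x, c) (x', b) := by
    rw [Finset.sum_eq_single x] <;> simp +contextual [eq_comm]
  have hright (b : Y) : ∑ y, ∑ c, (if y = x' then N (x, b) (y, c) * U c b else 0) =
      ∑ c, N (x, b) (x', c) * U c b := by
    rw [Finset.sum_eq_single x'] <;> simp +contextual [eq_comm]
  simp only [hleft, hright]
  rw [Finset.sum_comm]
  exact Finset.sum_congr rfl fun _ _ => Finset.sum_congr rfl fun _ _ => mul_comm _ _

theorem partialTrace_eq_zero_of_mul_eq_smul [Fintype X] [DecidableEq X] [DecidableEq Y]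
    {N : Matrix (X × Y) (X × Y) ℂ} {U U' : Matrix Y Y ℂ} {z : ℂ} (hU : U * U' = 1)
    (hU' : U' * U = 1) (hz : z ≠ 1)
    (hN : N * (1 : Matrix X X ℂ) ⊗ₖ U = z • ((1 : Matrix X X ℂ) ⊗ₖ U * N)) :
    partialTrace N = 0 := by
  have hself : z • partialTrace N = partialTrace N :=
    calc z • partialTrace N
        = z • partialTrace (N * ((1 : Matrix X X ℂ) ⊗ₖ U' * (1 : Matrix X X ℂ) ⊗ₖ U)) := by
          rw [← Matrix.mul_kronecker_mul, hU', Matrix.one_mul, Matrix.one_kronecker_one,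
            Matrix.mul_one]
      _ = partialTrace (N * ((1 : Matrix X X ℂ) ⊗ₖ U * (1 : Matrix X X ℂ) ⊗ₖ U')) := by
          rw [← Matrix.mul_assoc, ← partialTrace_mul_comm, ← Matrix.mul_assoc, ← map_smul,
            ← Matrix.smul_mul, ← hN, Matrix.mul_assoc]
      _ = partialTrace N := by
          rw [← Matrix.mul_kronecker_mul, hU, Matrix.one_mul, Matrix.one_kronecker_one,
            Matrix.mul_one]
  by_contra h0
  exact hz (smul_left_injective ℂ h0 (by simpa using hself))

end PartialTrace

section Detects

variable {q n k c : ℕ} (V : Matrix (Labels q n) (Labels q k × Labels q c) ℂ)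

/-- The operator applied to the information qudits when the `c` halves of the entangled pairs that
stay with the receiver are found in the state `b`. -/
def encodeBlock (b : Labels q c) : Matrix (Labels q n) (Labels q k) ℂ :=
  V.submatrix id fun x => (x, b)

theorem encode_apply (ψ : Labels q k → ℂ) (a : Labels q n) (b : Labels q c) :
    encode V ψ (a, b) = ((√((q : ℝ) ^ c) : ℝ) : ℂ)⁻¹ * (encodeBlock V b *ᵥ ψ) a := by
  simp only [encode, ebits, encodeBlock, Matrix.mulVec, dotProduct, Matrix.submatrix_apply, id_eq,
    mul_ite, mul_zero, Finset.sum_ite_eq', Finset.mem_univ, if_true, Finset.mul_sum]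
  exact Finset.sum_congr rfl fun x _ => by ring

theorem applyError_encode_apply (E : Matrix (Labels q n) (Labels q n) ℂ) (ψ : Labels q k → ℂ)
    (a : Labels q n) (b : Labels q c) : applyError E (encode V ψ) (a, b) =
      ((√((q : ℝ) ^ c) : ℝ) : ℂ)⁻¹ * ((E * encodeBlock V b) *ᵥ ψ) a := by
  rw [← Matrix.mulVec_mulVec, ← smul_eq_mul, ← Pi.smul_apply, ← Matrix.mulVec_smul]
  simp only [applyError, encode_apply]
  rfl

theorem partialTrace_conjTranspose_mul_mul (E : Matrix (Labels q n) (Labels q n) ℂ) :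
    partialTrace (Vᴴ * E * V) = ∑ b, (encodeBlock V b)ᴴ * E * encodeBlock V b := by
  ext x x'
  rw [Matrix.sum_apply]
  rfl

theorem dotProduct_applyError (E : Matrix (Labels q n) (Labels q n) ℂ) (φ ψ : Labels q k → ℂ) :
    star (encode V φ) ⬝ᵥ applyError E (encode V ψ) =
      ((q : ℂ) ^ c)⁻¹ * (star φ ⬝ᵥ partialTrace (Vᴴ * E * V) *ᵥ ψ) := by
  set t : ℂ := ((√((q : ℝ) ^ c) : ℝ) : ℂ)⁻¹ with ht
  have htt : star t * t = ((q : ℂ) ^ c)⁻¹ := by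
    rw [ht, ← Complex.ofReal_inv, Complex.star_def, Complex.conj_ofReal, ← Complex.ofReal_mul,
      ← mul_inv, Real.mul_self_sqrt (by positivity), Complex.ofReal_inv, Complex.ofReal_pow,
      Complex.ofReal_natCast]
  have hblock (b : Labels q c) :
      star φ ⬝ᵥ ((encodeBlock V b)ᴴ * E * encodeBlock V b) *ᵥ ψ =
        star (encodeBlock V b *ᵥ φ) ⬝ᵥ (E * encodeBlock V b) *ᵥ ψ := by
    rw [Matrix.star_mulVec, ← Matrix.dotProduct_mulVec, Matrix.mulVec_mulVec, Matrix.mul_assoc]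
  rw [partialTrace_conjTranspose_mul_mul, Matrix.sum_mulVec, dotProduct_sum, ← htt, Finset.mul_sum]
  simp only [hblock]
  simp only [dotProduct, Fintype.sum_prod_type_right, Pi.star_apply, encode_apply,
    applyError_encode_apply, star_mul', ← ht, Finset.mul_sum]
  exact Finset.sum_congr rfl fun b _ => Finset.sum_congr rfl fun a _ => by ring

theorem applyError_one (v : Labels q n × Labels q c → ℂ) : applyError 1 v = v := by
  ext p
  simp [applyError, Matrix.one_apply]

variable {V}

theorem dotProduct_encode [NeZero q] (hV : Vᴴ * V = 1) (φ ψ : Labels q k → ℂ) :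
    star (encode V φ) ⬝ᵥ encode V ψ = star φ ⬝ᵥ ψ := by
  have h := dotProduct_applyError V 1 φ ψ
  have hqc : (q : ℂ) ^ c ≠ 0 := pow_ne_zero _ (Nat.cast_ne_zero.2 (NeZero.ne q))
  rw [applyError_one, Matrix.mul_one, hV, partialTrace_one, Matrix.smul_mulVec, Matrix.one_mulVec,
    dotProduct_smul, smul_eq_mul] at h
  simpa [hqc] using h

theorem detects_iff [NeZero q] (hV : Vᴴ * V = 1) (E : Matrix (Labels q n) (Labels q n) ℂ) :
    Detects V E ↔ ∃ z : ℂ, partialTrace (Vᴴ * E * V) = z • 1 := by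
  have hqc : (q : ℂ) ^ c ≠ 0 := pow_ne_zero _ (Nat.cast_ne_zero.2 (NeZero.ne q))
  simp only [Detects, dotProduct_applyError, dotProduct_encode hV]
  constructor
  · rintro ⟨μ, h⟩
    refine ⟨(q : ℂ) ^ c * μ, Matrix.ext fun x y => ?_⟩
    have hxy := h (Pi.single x 1) (Pi.single y 1)
    rw [inv_mul_eq_iff_eq_mul₀ hqc, Pi.star_single, star_one, single_one_dotProduct,
      Matrix.mulVec_single_one, Matrix.col_apply, single_one_dotProduct, ← mul_assoc] at hxy
    rw [hxy, Matrix.smul_apply, Matrix.one_apply, Pi.single_apply, smul_eq_mul]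
  · rintro ⟨z, h⟩
    refine ⟨((q : ℂ) ^ c)⁻¹ * z, fun φ ψ => ?_⟩
    rw [h, Matrix.smul_mulVec, Matrix.one_mulVec, dotProduct_smul, smul_eq_mul, mul_assoc]

theorem Detects.of_mem_span [NeZero q] (hV : Vᴴ * V = 1)
    {s : Set (Matrix (Labels q n) (Labels q n) ℂ)} (hs : ∀ E ∈ s, Detects V E)
    {E : Matrix (Labels q n) (Labels q n) ℂ} (hE : E ∈ Submodule.span ℂ s) : Detects V E := by
  rw [detects_iff hV]
  induction hE using Submodule.span_induction with
  | mem E hE => exact (detects_iff hV E).1 (hs E hE)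
  | zero => exact ⟨0, by simp⟩
  | add A B _ _ hA hB =>
    obtain ⟨x, hx⟩ := hA
    obtain ⟨y, hy⟩ := hB
    exact ⟨x + y, by rw [Matrix.mul_add, Matrix.add_mul, map_add, hx, hy, add_smul]⟩
  | smul z A _ hA =>
    obtain ⟨x, hx⟩ := hA
    exact ⟨z * x, by rw [Matrix.mul_smul, Matrix.smul_mul, map_smul, hx, smul_smul]⟩

end Detects

section Stabilizer

open scoped Kronecker

variable {q n k c : ℕ} {H P : Type*} [AddCommGroup H] [AddCommGroup P]
  {β : AddChar H (AddChar H ℂ)} {w : H → Matrix (Fin q) (Fin q) ℂ}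
  {a : P →+ (Fin n → H)} {b : P →+ (Fin k → H) × (Fin c → H)}
  {V : Matrix (Labels q n) (Labels q k × Labels q c) ℂ}

theorem partialTrace_eq_zero_of_sq_ne_one (hβ : IsSymplectic β) (hw : IsWeylSystem β w)
    (hint : ∀ p, weylOp w (a p) * V = V * (weylOp w (b p).1 ⊗ₖ weylOp w (b p).2))
    {e : Fin n → H} {p : P} (hp : (b p).1 = 0) (he : piBicharacter (Fin n) β e (a p) ^ 2 ≠ 1) :
    partialTrace (Vᴴ * weylOp w e * V) = 0 := by
  set U : Matrix (Labels q k × Labels q c) (Labels q k × Labels q c) ℂ :=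
    (1 : Matrix (Labels q k) (Labels q k) ℂ) ⊗ₖ weylOp w (b p).2 with hU
  have hpos : weylOp w (a p) * V = V * U := by rw [hint, hp, hw.pi.zero]
  have hneg : weylOp w (-a p) * V = V * Uᴴ := by
    rw [← map_neg, hint, hU, Matrix.conjTranspose_kronecker, hw.pi.conjTranspose,
      Matrix.conjTranspose_one, map_neg, Prod.fst_neg, hp, neg_zero, hw.pi.zero, Prod.snd_neg]
  have hadj : Vᴴ * weylOp w (a p) = U * Vᴴ := by
    simpa only [Matrix.conjTranspose_mul, hw.pi.conjTranspose, neg_neg,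
      Matrix.conjTranspose_conjTranspose] using congrArg Matrix.conjTranspose hneg
  refine partialTrace_eq_zero_of_mul_eq_smul (hw.pi.mul_neg hβ.pi (b p).2)
    (hw.pi.neg_mul hβ.pi (b p).2) he ?_
  rw [Matrix.mul_assoc, ← hpos, ← Matrix.mul_assoc, Matrix.mul_assoc Vᴴ, hw.pi.mul_comm hβ.pi,
    Matrix.mul_smul, Matrix.smul_mul, ← Matrix.mul_assoc, hadj]
  simp only [Matrix.mul_assoc, hU]

theorem partialTrace_conjTranspose_mul_weylOp_mul (hw : IsWeylSystem β w) (hV : Vᴴ * V = 1)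
    (hint : ∀ p, weylOp w (a p) * V = V * (weylOp w (b p).1 ⊗ₖ weylOp w (b p).2))
    {p : P} (hp : (b p).2 = 0) :
    partialTrace (Vᴴ * weylOp w (a p) * V) = (q : ℂ) ^ c • weylOp w (b p).1 := by
  rw [Matrix.mul_assoc, hint, ← Matrix.mul_assoc, hV, Matrix.one_mul, partialTrace_kronecker, hp,
    hw.pi.zero, Matrix.trace_one]
  simp

theorem detects_weylOp_iff [NeZero q] [Finite H] (hβ : IsSymplectic β) (hw : IsWeylSystem β w)
    (ha : Function.Injective a)
    (hab : ∀ p p', piBicharacter (Fin n) β (a p) (a p') =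
      prodBicharacter (piBicharacter (Fin k) β) (piBicharacter (Fin c) β) (b p) (b p'))
    (hV : Vᴴ * V = 1)
    (hint : ∀ p, weylOp w (a p) * V = V * (weylOp w (b p).1 ⊗ₖ weylOp w (b p).2))
    (hmax : ∀ e, (∀ p, (b p).1 = 0 → piBicharacter (Fin n) β e (a p) ^ 2 = 1) →
      ∃ p, a p = e ∧ (b p).2 = 0) (e : Fin n → H) :
    Detects V (weylOp w e) ↔ ∀ p, a p = e → (b p).2 = 0 → (b p).1 = 0 := by
  rw [detects_iff hV]
  by_cases he : ∀ p, (b p).1 = 0 → piBicharacter (Fin n) β e (a p) ^ 2 = 1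
  · obtain ⟨p, rfl, hp⟩ := hmax e he
    have hqc : (q : ℂ) ^ c ≠ 0 := pow_ne_zero _ (Nat.cast_ne_zero.2 (NeZero.ne q))
    rw [partialTrace_conjTranspose_mul_weylOp_mul hw hV hint hp]
    constructor
    · rintro ⟨z, hz⟩ p' hp' -
      rw [ha hp']
      refine hw.pi.eq_zero_of_eq_smul_one hβ.pi (z := ((q : ℂ) ^ c)⁻¹ * z) ?_
      rw [mul_smul, ← hz, inv_smul_smul₀ hqc]
    · intro h
      exact ⟨(q : ℂ) ^ c, by rw [h p rfl hp, hw.pi.zero]⟩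
  · push Not at he
    obtain ⟨p', hp', hne⟩ := he
    refine iff_of_true ⟨0, ?_⟩ fun p hpe hp2 => ?_
    · rw [zero_smul, partialTrace_eq_zero_of_sq_ne_one hβ hw hint hp' hne]
    · refine absurd ?_ hne
      rw [← hpe, hab, prodBicharacter_apply, hp', hp2, AddChar.map_zero_eq_one,
        AddChar.map_zero_eq_one, AddChar.one_apply, one_mul, one_pow]

/-- The errors `a p` form the normalizer of the stabilizer `{a p | b p = 0}`, and `W (a p)` acts as
the Weyl operator `b p` on the information qudits and the sender's halves of the pairs. -/
theorem existsEAQECC_of_weylSystem [NeZero q] [Finite H] [Finite P] (hβ : IsSymplectic β)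
    (hw : IsWeylSystem β w) (hcard : Nat.card H = q ^ 2) (ha : Function.Injective a)
    (hb : Function.Surjective b)
    (hab : ∀ p p', piBicharacter (Fin n) β (a p) (a p') =
      prodBicharacter (piBicharacter (Fin k) β) (piBicharacter (Fin c) β) (b p) (b p'))
    (hmax : ∀ e, (∀ p, (b p).1 = 0 → piBicharacter (Fin n) β e (a p) ^ 2 = 1) →
      ∃ p, a p = e ∧ (b p).2 = 0) [DecidableEq H] {d : ℕ}
    (hd : IsLeast {t | ∃ p, (b p).2 = 0 ∧ (b p).1 ≠ 0 ∧ hammingNorm (a p) = t} d) :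
    ExistsEAQECC q n k d c := by
  obtain ⟨V, hV, hint⟩ := exists_isometry (L := Labels q n) (L' := Labels q k × Labels q c)
    hβ.pi (hβ.pi.prod hβ.pi) hw.pi (hw.pi.prod hw.pi) (by
      simp only [Nat.card_prod, Nat.card_fun, hcard, Nat.card_fin, Fintype.card_prod,
        Fintype.card_fun, Fintype.card_fin, mul_pow, ← pow_mul, mul_comm]) ha hb hab
  have hdet := detects_weylOp_iff hβ hw ha hab hV hint hmax
  refine ⟨V, hV, ?_, ?_⟩
  · obtain ⟨p, hp2, hp1, rfl⟩ := hd.1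
    refine ⟨Finset.univ.filter (a p · ≠ 0), weylOp w (a p), rfl, hw.actsOn_weylOp (by simp),
      fun h => hp1 ?_⟩
    exact (hdet _).1 h p rfl hp2
  · rintro _ ⟨S, E, rfl, hES, hE⟩
    obtain ⟨e, he, hVe⟩ : ∃ e : Fin n → H, (∀ i ∉ S, e i = 0) ∧ ¬ Detects V (weylOp w e) := by
      by_contra! h
      refine hE (Detects.of_mem_span hV ?_ (hES.mem_span hβ hw hcard))
      rintro _ ⟨e, he, rfl⟩
      exact h e he
    rw [hdet] at hVe
    push Not at hVe
    obtain ⟨p, rfl, hp2, hp1⟩ := hVe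
    refine (hd.2 ⟨p, hp2, hp1, rfl⟩).trans (Finset.card_le_card fun i hi => ?_)
    by_contra hiS
    exact (Finset.mem_filter.1 hi).2 (he i hiS)

end Stabilizer

/-! ### Weyl operators of one qudit -/

section Qudit

variable {F : Type*} [Field F] [StarRing F] {ψ : AddChar F ℂ} {γ : F}

/-- The bicharacter `x, y ↦ ψ (x * star y - star x * y)` attached to the one-dimensional Hermitian
form over `F`. -/
def hermBicharacter (ψ : AddChar F ℂ) : AddChar F (AddChar F ℂ) where
  toFun x :=
    { toFun := fun y => ψ (x * star y - star x * y)
      map_zero_eq_one' := by simp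
      map_add_eq_mul' := fun y y' => by
        rw [← AddChar.map_add_eq_mul, star_add]
        ring_nf }
  map_zero_eq_one' := by ext; simp
  map_add_eq_mul' x x' := by
    ext y
    simp only [AddChar.mul_apply, AddChar.coe_mk, star_add]
    rw [← AddChar.map_add_eq_mul]
    ring_nf

theorem hermBicharacter_apply (x y : F) :
    hermBicharacter ψ x y = ψ (x * star y - star x * y) := rfl

theorem isSymplectic_hermBicharacter (hγ : star γ = -γ) (hψ : ψ γ ^ 2 ≠ 1) (h2 : (2 : F) ≠ 0) :
    IsSymplectic (hermBicharacter ψ) where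
  self x := by rw [hermBicharacter_apply, mul_comm, sub_self, AddChar.map_zero_eq_one]
  nondegenerate x hx := by
    refine ⟨star (γ / (2 * x)), ?_⟩
    have hx' : star x ≠ 0 := star_ne_zero.2 hx
    have h2' : star (2 : F) = 2 := star_ofNat 2
    have hpair : x * star (star (γ / (2 * x))) - star x * star (γ / (2 * x)) = γ := by
      rw [star_star, star_div₀, star_mul', hγ, h2']
      field_simp
      ring
    rwa [hermBicharacter_apply, hpair]

theorem card_selfAdjoint_sq (hγ0 : γ ≠ 0) (hγ : star γ = -γ) (h2 : (2 : F) ≠ 0) :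
    Nat.card (selfAdjoint F) ^ 2 = Nat.card F := by
  have h2' : star (2 : F) = 2 := star_ofNat 2
  let toField : selfAdjoint F × selfAdjoint F → F := fun p => p.1 + γ * p.2
  have hstar (p) : star (toField p) = p.1 - γ * p.2 := by
    simp only [toField, star_add, star_mul', hγ, selfAdjoint.star_val_eq]
    ring
  rw [sq, ← Nat.card_prod]
  refine Nat.card_congr (Equiv.ofBijective toField ⟨fun p p' h => ?_, fun x => ?_⟩)
  · have h' := congrArg star h
    rw [hstar, hstar] at h'
    simp only [toField] at h
    refine Prod.ext (Subtype.ext (mul_left_cancel₀ h2 ?_))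
      (Subtype.ext (mul_left_cancel₀ (mul_ne_zero h2 hγ0) ?_))
    · linear_combination h + h'
    · linear_combination h - h'
  · refine ⟨⟨⟨(x + star x) / 2, ?_⟩, ⟨(x - star x) / (2 * γ), ?_⟩⟩, ?_⟩
    · rw [selfAdjoint.mem_iff, star_div₀, star_add, star_star, h2', add_comm]
    · rw [selfAdjoint.mem_iff, star_div₀, star_sub, star_star, star_mul', h2', hγ, mul_neg,
        div_neg, ← neg_div, neg_sub]
    · simp only [toField]
      field_simp
      ring

/-- The Weyl operators of one qudit with basis labels in the fixed field of `star`: up to phases,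
the label is shifted by `e + star e` and multiplied by the character `z ↦ ψ ((e - star e) * z)`. -/
def weylMatrix [DecidableEq F] (ψ : AddChar F ℂ) (e : F) :
    Matrix (selfAdjoint F) (selfAdjoint F) ℂ :=
  Matrix.of fun x z => if (x : F) = z + (e + star e) then
    ψ ((e - star e) * z + (e - star e) * (e + star e) / 2) else 0

theorem weylMatrix_zero [DecidableEq F] : weylMatrix ψ (0 : F) = 1 := by
  ext x z
  simp only [weylMatrix, Matrix.of_apply, Matrix.one_apply, star_zero, add_zero, sub_zero, zero_mul,
    zero_div, AddChar.map_zero_eq_one, Subtype.ext_iff]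

theorem weylMatrix_mul [DecidableEq F] [Fintype (selfAdjoint F)] (h2 : (2 : F) ≠ 0) (e f : F) :
    weylMatrix ψ e * weylMatrix ψ f = hermBicharacter ψ e f • weylMatrix ψ (e + f) := by
  ext x z
  let y : selfAdjoint F := z + ⟨f + star f, IsSelfAdjoint.add_star_self f⟩
  have hy : (y : F) = z + (f + star f) := rfl
  have hshift : (x : F) = y + (e + star e) ↔ (x : F) = z + (e + f + star (e + f)) := by
    rw [hy, star_add, add_assoc]
    ring_nf
  rw [Matrix.mul_apply, Finset.sum_eq_single y]
  · simp only [weylMatrix, Matrix.smul_apply, Matrix.of_apply, ← hy, if_true, hshift, ite_mul,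
      zero_mul, smul_eq_mul, mul_ite, mul_zero]
    refine if_congr Iff.rfl ?_ rfl
    rw [hermBicharacter_apply, ← AddChar.map_add_eq_mul, ← AddChar.map_add_eq_mul, star_add, hy]
    congr 1
    field_simp
    ring
  · intro y' _ hy'
    have hne : (y' : F) ≠ z + (f + star f) := fun h => hy' (Subtype.ext h)
    simp [weylMatrix, hne]
  · simp

theorem conjTranspose_weylMatrix [DecidableEq F] [Finite F] (h2 : (2 : F) ≠ 0) (e : F) :
    (weylMatrix ψ e)ᴴ = weylMatrix ψ (-e) := by
  ext x z
  have hshift : (z : F) = x + (e + star e) ↔ (x : F) = z + (-e + star (-e)) := by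
    rw [star_neg]
    constructor <;> intro h <;> rw [h] <;> ring
  simp only [Matrix.conjTranspose_apply, weylMatrix, Matrix.of_apply, ← hshift]
  split_ifs with hz
  · rw [Complex.star_def, ← AddChar.map_neg_eq_conj, star_neg, hz]
    congr 1
    field_simp
    ring
  · exact star_zero ℂ

theorem exists_isWeylSystem [Finite F] {q : ℕ} (hcard : Nat.card F = q ^ 2) (h2 : (2 : F) ≠ 0)
    (hγ0 : γ ≠ 0) (hγ : star γ = -γ) :
    ∃ ψ : AddChar F ℂ, IsSymplectic (hermBicharacter ψ) ∧
      ∃ w : F → Matrix (Fin q) (Fin q) ℂ, IsWeylSystem (hermBicharacter ψ) w := by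
  classical
  have := Fintype.ofFinite (selfAdjoint F)
  obtain ⟨ψ, hψ⟩ := (AddChar.exists_apply_ne_zero (a := 2 * γ)).2 (mul_ne_zero h2 hγ0)
  rw [two_mul, AddChar.map_add_eq_mul, ← sq] at hψ
  refine ⟨ψ, isSymplectic_hermBicharacter hγ hψ h2, ?_⟩
  have hq : Nat.card (selfAdjoint F) = q :=
    Nat.pow_left_injective two_ne_zero ((card_selfAdjoint_sq hγ0 hγ h2).trans hcard)
  let label : Fin q ≃ selfAdjoint F := (finCongr hq.symm).trans (Finite.equivFin _).symm
  refine ⟨fun e => (weylMatrix ψ e).submatrix label label, ?_, fun e f => ?_, fun e => ?_⟩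
  · rw [weylMatrix_zero, Matrix.submatrix_one_equiv]
  · rw [Matrix.submatrix_mul_equiv, weylMatrix_mul h2]
    rfl
  · rw [Matrix.conjTranspose_submatrix, conjTranspose_weylMatrix h2]

end Qudit

/-! ### Hermitian geometry over a finite field -/

section Hermitian

variable {F ι : Type*} [Field F] [StarRing F] [Fintype ι]

/-- The Hermitian dual of `W`: the vectors `x` with `∑ i, x i * star (y i) = 0` for all `y ∈ W`. -/
def hermDual (W : Submodule F (ι → F)) : Submodule F (ι → F) where
  carrier := {x | ∀ y ∈ W, x ⬝ᵥ star y = 0}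
  zero_mem' y _ := zero_dotProduct _
  add_mem' hx hx' y hy := by rw [add_dotProduct, hx y hy, hx' y hy, add_zero]
  smul_mem' a x hx y hy := by rw [smul_dotProduct, hx y hy, smul_zero]

variable {W : Submodule F (ι → F)}

theorem mem_hermDual {x : ι → F} : x ∈ hermDual W ↔ ∀ y ∈ W, x ⬝ᵥ star y = 0 := Iff.rfl

theorem dotProduct_star_eq_zero_comm {x y : ι → F} : x ⬝ᵥ star y = 0 ↔ y ⬝ᵥ star x = 0 := by
  rw [Matrix.dotProduct_star, star_eq_zero]

theorem dotProduct_star_eq_zero_of_isotropic (h2 : (2 : F) ≠ 0)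
    (h : ∀ x ∈ W, x ⬝ᵥ star x = 0) {x y : ι → F} (hx : x ∈ W) (hy : y ∈ W) :
    x ⬝ᵥ star y = 0 := by
  set t := x ⬝ᵥ star y with ht
  by_contra h0
  have hyx : y ⬝ᵥ star x = star t := Matrix.dotProduct_star ..
  have hsum := h (x + star t⁻¹ • y) (W.add_mem hx (W.smul_mem _ hy))
  rw [star_add, star_smul, star_star, add_dotProduct, dotProduct_add, dotProduct_add,
    smul_dotProduct, smul_dotProduct, dotProduct_smul, dotProduct_smul, h x hx, h y hy, hyx, ← ht,
    star_inv₀, smul_eq_mul, smul_eq_mul, inv_mul_cancel₀ h0, inv_mul_cancel₀ (star_ne_zero.2 h0),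
    smul_zero, smul_zero, add_zero, zero_add, one_add_one_eq_two] at hsum
  exact h2 hsum

theorem exists_mul_star_eq [Finite F] {γ : F} (hγ0 : γ ≠ 0) (hγ : star γ = -γ) (h2 : (2 : F) ≠ 0)
    {a : F} (ha : star a = a) : ∃ b, b * star b = a := by
  have := Fintype.ofFinite (selfAdjoint F)
  have hγγ : star (γ ^ 2) = γ ^ 2 := by rw [star_pow, hγ, neg_sq]
  have hodd : Fintype.card (selfAdjoint F) % 2 = 1 := by
    refine FiniteField.odd_card_of_char_ne_two fun hchar => h2 ?_
    have htwo := ringChar.Nat.cast_ringChar (R := selfAdjoint F)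
    rw [hchar] at htwo
    exact congrArg Subtype.val htwo
  have hne : -(⟨γ ^ 2, hγγ⟩ : selfAdjoint F) ≠ 0 := fun h =>
    pow_ne_zero 2 hγ0 (by simpa using congrArg Subtype.val h)
  -- the norm of `x + γ y` is the binary quadratic form `x ^ 2 - γ ^ 2 y ^ 2`, which is universal
  obtain ⟨x, y, hxy⟩ := FiniteField.exists_root_sum_quadratic
    (f := X ^ 2 - Polynomial.C (⟨a, ha⟩ : selfAdjoint F))
    (g := Polynomial.C (-(⟨γ ^ 2, hγγ⟩ : selfAdjoint F)) * X ^ 2)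
    (degree_X_pow_sub_C two_pos _) (degree_C_mul_X_pow 2 hne) hodd
  refine ⟨x + γ * y, ?_⟩
  have hxy' := congrArg (Subtype.val (p := (· ∈ selfAdjoint F))) hxy
  simp only [eval_sub, eval_mul, eval_pow, eval_X, eval_C, AddSubgroup.coe_add,
    AddSubgroup.coe_sub, selfAdjoint.val_pow, selfAdjoint.val_mul, AddSubgroup.coe_neg,
    AddSubgroup.coe_zero] at hxy'
  simp only [star_add, star_mul', hγ, selfAdjoint.star_val_eq]
  linear_combination hxy'

/-- The rows of `U` are an orthonormal family in `W`. -/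
structure IsOrthonormalIn {κ : Type*} [DecidableEq κ] (W : Submodule F (ι → F))
    (U : Matrix κ ι F) : Prop where
  mem (i : κ) : U i ∈ W
  mul_conjTranspose : U * Uᴴ = 1

/-- The rows of `U` are an orthonormal basis of `W` modulo its radical `W ⊓ hermDual W`. -/
structure IsOrthonormalBasis {κ : Type*} [Fintype κ] [DecidableEq κ] (W : Submodule F (ι → F))
    (U : Matrix κ ι F) : Prop extends IsOrthonormalIn W U where
  sub_mem_hermDual {x : ι → F} : x ∈ W → x - (x ᵥ* Uᴴ) ᵥ* U ∈ hermDual W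

theorem dotProduct_star_vecMul {κ : Type*} [Fintype κ] (U : Matrix κ ι F) (x : ι → F) (f : κ → F) :
    x ⬝ᵥ star (f ᵥ* U) = (x ᵥ* Uᴴ) ⬝ᵥ star f := by
  rw [Matrix.star_vecMul, Matrix.dotProduct_mulVec]

theorem IsOrthonormalIn.vecMul_eq_zero {κ : Type*} [DecidableEq κ] {U : Matrix κ ι F}
    (hU : IsOrthonormalIn W U) {x : ι → F} (hx : x ∈ hermDual W) : x ᵥ* Uᴴ = 0 :=
  funext fun i => hx _ (hU.mem i)

section Family

variable {κ : Type*} [Fintype κ] [DecidableEq κ] {U : Matrix κ ι F}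

theorem IsOrthonormalIn.vecMul_mem (hU : IsOrthonormalIn W U) (f : κ → F) : f ᵥ* U ∈ W := by
  rw [Matrix.vecMul_eq_sum]
  exact W.sum_mem fun i _ => W.smul_mem _ (hU.mem i)

theorem IsOrthonormalIn.vecMul_vecMul (hU : IsOrthonormalIn W U) (f : κ → F) :
    (f ᵥ* U) ᵥ* Uᴴ = f := by
  rw [Matrix.vecMul_vecMul, hU.mul_conjTranspose, Matrix.vecMul_one]

theorem IsOrthonormalIn.sub_vecMul_vecMul (hU : IsOrthonormalIn W U) (x : ι → F) :
    (x - (x ᵥ* Uᴴ) ᵥ* U) ᵥ* Uᴴ = 0 := by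
  rw [Matrix.sub_vecMul, hU.vecMul_vecMul, sub_self]

theorem IsOrthonormalIn.sub_mem (hU : IsOrthonormalIn W U) {x : ι → F} (hx : x ∈ W) :
    x - (x ᵥ* Uᴴ) ᵥ* U ∈ W :=
  W.sub_mem hx (hU.vecMul_mem _)

theorem IsOrthonormalIn.card_le (hU : IsOrthonormalIn W U) :
    Fintype.card κ ≤ Fintype.card ι := by
  rw [← Matrix.rank_one (R := F) (n := κ), ← hU.mul_conjTranspose]
  exact (Matrix.rank_mul_le_left _ _).trans (Matrix.rank_le_card_width _)

theorem IsOrthonormalIn.isOrthonormalBasis (hU : IsOrthonormalIn W U) (h2 : (2 : F) ≠ 0)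
    (hmax : ∀ x ∈ W, x ᵥ* Uᴴ = 0 → x ⬝ᵥ star x = 0) : IsOrthonormalBasis W U where
  toIsOrthonormalIn := hU
  sub_mem_hermDual {x} hx y hy := by
    have hperp := dotProduct_star_eq_zero_of_isotropic (W := W ⊓ LinearMap.ker Uᴴ.vecMulLinear) h2
      (fun z hz => hmax z hz.1 hz.2) ⟨hU.sub_mem hx, hU.sub_vecMul_vecMul x⟩
      ⟨hU.sub_mem hy, hU.sub_vecMul_vecMul y⟩
    rwa [star_sub, dotProduct_sub, dotProduct_star_vecMul, hU.sub_vecMul_vecMul, zero_dotProduct,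
      sub_zero] at hperp

theorem IsOrthonormalBasis.mem_hermDual_iff (hU : IsOrthonormalBasis W U) {x : ι → F}
    (hx : x ∈ W) : x ∈ hermDual W ↔ x ᵥ* Uᴴ = 0 := by
  refine ⟨hU.vecMul_eq_zero, fun h => ?_⟩
  simpa [h] using hU.sub_mem_hermDual hx

theorem IsOrthonormalBasis.dotProduct_star (hU : IsOrthonormalBasis W U) {x y : ι → F}
    (hx : x ∈ W) (hy : y ∈ W) : x ⬝ᵥ star y = (x ᵥ* Uᴴ) ⬝ᵥ star (y ᵥ* Uᴴ) := by
  have hxy := hU.sub_mem_hermDual hx y hy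
  rw [sub_dotProduct, sub_eq_zero] at hxy
  rw [hxy, Matrix.dotProduct_star, dotProduct_star_vecMul, ← Matrix.dotProduct_star]

theorem IsOrthonormalBasis.card_add_finrank (hU : IsOrthonormalBasis W U) :
    Fintype.card κ + Module.finrank F ↥(W ⊓ hermDual W) = Module.finrank F W := by
  let f : W →ₗ[F] (κ → F) := Uᴴ.vecMulLinear ∘ₗ W.subtype
  have hf : Function.Surjective f := fun a => ⟨⟨a ᵥ* U, hU.vecMul_mem a⟩, hU.vecMul_vecMul a⟩
  have hker : (LinearMap.ker f).map W.subtype = W ⊓ hermDual W := by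
    ext x
    simp only [Submodule.mem_map, LinearMap.mem_ker, Submodule.mem_inf]
    constructor
    · rintro ⟨y, hy, rfl⟩
      exact ⟨y.2, (hU.mem_hermDual_iff y.2).2 hy⟩
    · rintro ⟨hx, hx'⟩
      exact ⟨⟨x, hx⟩, (hU.mem_hermDual_iff hx).1 hx', rfl⟩
  rw [← hker, Submodule.finrank_map_subtype_eq, ← f.finrank_range_add_finrank_ker,
    LinearMap.range_eq_top.2 hf, finrank_top, Module.finrank_fintype_fun_eq_card]

end Family

theorem IsOrthonormalIn.cons {t : ℕ} {U : Matrix (Fin t) ι F} (hU : IsOrthonormalIn W U)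
    {v : ι → F} (hv : v ∈ W) (hvU : v ᵥ* Uᴴ = 0) (hvv : v ⬝ᵥ star v = 1) :
    IsOrthonormalIn W (Matrix.of (Fin.cons v U.row)) where
  mem := Fin.cases hv hU.mem
  mul_conjTranspose := by
    have hleft (i : Fin t) : v ⬝ᵥ star (U i) = 0 := congrFun hvU i
    ext i j
    induction i using Fin.cases with
    | zero =>
      induction j using Fin.cases with
      | zero => exact hvv
      | succ j => exact hleft j
    | succ i =>
      induction j using Fin.cases with
      | zero => exact dotProduct_star_eq_zero_comm.1 (hleft i)
      | succ j =>
        simp only [Matrix.one_apply, Fin.succ_inj]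
        rw [← Matrix.one_apply, ← hU.mul_conjTranspose]
        rfl

theorem exists_isOrthonormalBasis [Finite F] {γ : F} (hγ0 : γ ≠ 0) (hγ : star γ = -γ)
    (h2 : (2 : F) ≠ 0) (W : Submodule F (ι → F)) :
    ∃ (t : ℕ) (U : Matrix (Fin t) ι F), IsOrthonormalBasis W U := by
  by_contra! hnot
  have hall (t : ℕ) : ∃ U : Matrix (Fin t) ι F, IsOrthonormalIn W U := by
    induction t with
    | zero => exact ⟨0, fun i => i.elim0, Subsingleton.elim _ _⟩
    | succ t ih =>
      obtain ⟨U, hU⟩ := ih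
      obtain ⟨x, hx, hxU, hxx⟩ : ∃ x ∈ W, x ᵥ* Uᴴ = 0 ∧ x ⬝ᵥ star x ≠ 0 := by
        by_contra! h
        exact hnot t U (hU.isOrthonormalBasis h2 h)
      obtain ⟨b, hb⟩ := exists_mul_star_eq hγ0 hγ h2 (a := (x ⬝ᵥ star x)⁻¹) (by
        rw [star_inv₀, ← Matrix.dotProduct_star])
      refine ⟨_, hU.cons (W.smul_mem b hx) ?_ ?_⟩
      · rw [Matrix.smul_vecMul, hxU, smul_zero]
      · rw [star_smul, smul_dotProduct, dotProduct_smul, smul_smul, hb, smul_eq_mul,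
          inv_mul_cancel₀ hxx]
  obtain ⟨U, hU⟩ := hall (Fintype.card ι + 1)
  simpa using hU.card_le

end Hermitian

/-! ### Entanglement-assisted codes from linear codes -/

section ParityCheck

variable {F : Type*} [Field F] {m n : ℕ} {H : Matrix (Fin m) (Fin n) F}
  {C : Submodule F (Fin n → F)}

theorem IsParityCheck.ker_mulVecLin (hH : IsParityCheck H C) : LinearMap.ker H.mulVecLin = C := by
  ext c
  rw [hH.2, LinearMap.mem_ker, Matrix.mulVecLin_apply]

theorem IsParityCheck.mulVecLin_surjective (hH : IsParityCheck H C) :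
    Function.Surjective H.mulVecLin := by
  refine LinearMap.range_eq_top.1 (Submodule.eq_top_of_finrank_eq ?_)
  rw [Module.finrank_fin_fun, ← Matrix.rank, hH.1.rank_matrix, Fintype.card_fin]

theorem IsParityCheck.exists_right_inverse (hH : IsParityCheck H C) :
    ∃ B : Matrix (Fin n) (Fin m) F, H * B = 1 :=
  Matrix.mulVec_surjective_iff_exists_right_inverse.1 hH.mulVecLin_surjective

theorem IsParityCheck.card_add_finrank (hH : IsParityCheck H C) :
    m + Module.finrank F C = n := by
  have hrank := LinearMap.finrank_range_add_finrank_ker H.mulVecLin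
  rwa [LinearMap.range_eq_top.2 hH.mulVecLin_surjective, finrank_top, Module.finrank_fin_fun,
    Module.finrank_fin_fun, hH.ker_mulVecLin] at hrank

theorem exists_isParityCheck (C : Submodule F (Fin n → F)) :
    ∃ (m : ℕ) (H : Matrix (Fin m) (Fin n) F), IsParityCheck H C := by
  let coords := (Module.finBasis F ((Fin n → F) ⧸ C)).equivFun
  let f : (Fin n → F) →ₗ[F] (Fin _ → F) := coords.toLinearMap ∘ₗ C.mkQ
  have hf : Function.Surjective f := coords.surjective.comp C.mkQ_surjective
  refine ⟨_, LinearMap.toMatrix' f, ?_, fun c => ?_⟩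
  · refine Matrix.vecMul_injective_iff.1 fun y z hyz => dotProduct_eq _ _ fun x => ?_
    obtain ⟨x, rfl⟩ := hf x
    simp only at hyz
    rw [← LinearMap.toMatrix'_mulVec, Matrix.dotProduct_mulVec, Matrix.dotProduct_mulVec, hyz]
  · rw [LinearMap.toMatrix'_mulVec]
    simp [f]

theorem isLeast_hammingNorm_notMem [DecidableEq F] {d : ℕ} (hd : HasMinDist C d)
    (hspan : C ≤ Submodule.span F {e | e ∈ C ∧ hammingNorm e = d}) {R : Submodule F (Fin n → F)}
    (hR : ¬ C ≤ R) : IsLeast {t | ∃ e ∈ C, e ∉ R ∧ hammingNorm e = t} d := by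
  refine ⟨?_, ?_⟩
  · by_contra! h
    exact hR (hspan.trans (Submodule.span_le.2 fun e he => by_contra fun heR =>
      h ⟨e, he.1, heR, he.2⟩))
  · rintro _ ⟨e, he, heR, rfl⟩
    exact hd.2 ⟨e, he, fun h => heR (h ▸ R.zero_mem), rfl⟩

variable [StarRing F]

theorem dotProduct_star_mulVec {ι κ : Type*} [Fintype ι] [Fintype κ] (A : Matrix ι κ F)
    (x : ι → F) (z : κ → F) : x ⬝ᵥ star (A *ᵥ z) = (Aᴴ *ᵥ x) ⬝ᵥ star z := by
  rw [Matrix.star_mulVec, dotProduct_comm, ← Matrix.dotProduct_mulVec, dotProduct_comm]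

theorem IsParityCheck.mem_iff_forall_dotProduct (hH : IsParityCheck H C) (x : Fin n → F) :
    x ∈ C ↔ ∀ z, x ⬝ᵥ star (Hᴴ *ᵥ z) = 0 := by
  simp only [hH.2, dotProduct_star_mulVec, Matrix.conjTranspose_conjTranspose]
  refine ⟨fun h z => by rw [h, zero_dotProduct], fun h => dotProduct_eq_zero _ fun z => ?_⟩
  simpa using h (star z)

theorem IsParityCheck.hermDual_eq_range (hH : IsParityCheck H C) :
    hermDual C = LinearMap.range Hᴴ.mulVecLin := by
  refine le_antisymm (fun y hy => ?_) ?_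
  · obtain ⟨B, hB⟩ := hH.exists_right_inverse
    refine ⟨Bᴴ *ᵥ y, sub_eq_zero.1 (dotProduct_eq_zero _ fun x => ?_)⟩
    have hx : star x - B *ᵥ (H *ᵥ star x) ∈ C := by
      rw [hH.2, Matrix.mulVec_sub, Matrix.mulVec_mulVec, hB, Matrix.one_mulVec, sub_self]
    have hyx := hy _ hx
    rw [star_sub, dotProduct_sub, dotProduct_star_mulVec, dotProduct_star_mulVec, star_star] at hyx
    rw [sub_dotProduct, Matrix.mulVecLin_apply, ← neg_sub, hyx, neg_zero]
  · rintro _ ⟨z, rfl⟩ c hc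
    exact dotProduct_star_eq_zero_comm.1 ((hH.mem_iff_forall_dotProduct c).1 hc z)

theorem IsParityCheck.hermDual_hermDual (hH : IsParityCheck H C) : hermDual (hermDual C) = C := by
  ext x
  simp [mem_hermDual, hH.hermDual_eq_range, hH.mem_iff_forall_dotProduct]

theorem IsParityCheck.conjTranspose_mulVecLin_injective (hH : IsParityCheck H C) :
    Function.Injective Hᴴ.mulVecLin := by
  obtain ⟨B, hB⟩ := hH.exists_right_inverse
  refine Function.LeftInverse.injective (g := Bᴴ.mulVecLin) fun z => ?_
  rw [Matrix.mulVecLin_apply, Matrix.mulVecLin_apply, Matrix.mulVec_mulVec,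
    ← Matrix.conjTranspose_mul, hB, Matrix.conjTranspose_one, Matrix.one_mulVec]

theorem IsParityCheck.finrank_hermDual (hH : IsParityCheck H C) :
    Module.finrank F (hermDual C) = m := by
  rw [hH.hermDual_eq_range, LinearMap.finrank_range_of_inj hH.conjTranspose_mulVecLin_injective,
    Module.finrank_fin_fun]

theorem IsParityCheck.rank_add_finrank (hH : IsParityCheck H C) :
    (H * Hᴴ).rank + Module.finrank F ↥(C ⊓ hermDual C) = m := by
  have hker : C ⊓ hermDual C = (LinearMap.ker (H * Hᴴ).mulVecLin).map Hᴴ.mulVecLin := by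
    rw [Matrix.mulVecLin_mul, LinearMap.ker_comp, Submodule.map_comap_eq, hH.ker_mulVecLin,
      hH.hermDual_eq_range, inf_comm]
  rw [hker, ← (Submodule.equivMapOfInjective _ hH.conjTranspose_mulVecLin_injective _).finrank_eq,
    Matrix.rank, LinearMap.finrank_range_add_finrank_ker, Module.finrank_fin_fun]

end ParityCheck

section Construction

variable {F : Type*} [Field F] [StarRing F] {n k c : ℕ} {C : Submodule F (Fin n → F)}
  {ψ : AddChar F ℂ}

theorem piBicharacter_hermBicharacter {ι : Type*} [Fintype ι] (x y : ι → F) :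
    piBicharacter ι (hermBicharacter ψ) x y = hermBicharacter ψ (x ⬝ᵥ star y) 1 := by
  simp only [piBicharacter_apply, hermBicharacter_apply, star_one, mul_one, dotProduct,
    Pi.star_apply, star_sum, star_mul', star_star, ← Finset.sum_sub_distrib]
  exact (map_prod ψ.toMonoidHom (fun i => .ofAdd (x i * star (y i) - star (x i) * y i)) _).symm

theorem IsSymplectic.eq_zero_of_forall_mul (hψ : IsSymplectic (hermBicharacter ψ)) {z : F}
    (h : ∀ a, hermBicharacter ψ (a * z) 1 ^ 2 = 1) : z = 0 := by
  by_contra hz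
  obtain ⟨f, hf⟩ := hψ.nondegenerate z hz
  refine hf ((congrArg (· ^ 2) ?_).trans (h (star f)))
  simp only [hermBicharacter_apply, star_mul', star_star, star_one, mul_one]
  ring_nf

theorem vecMul_eq_zero_iff_mem (hC : hermDual (hermDual C) = C) {U : Matrix (Fin c) (Fin n) F}
    (hU : IsOrthonormalBasis (hermDual C) U) {x : Fin n → F} (hx : x ∈ C ⊔ hermDual C) :
    x ᵥ* Uᴴ = 0 ↔ x ∈ C := by
  have hzero {y} (hy : y ∈ C) : y ᵥ* Uᴴ = 0 := hU.vecMul_eq_zero (by rwa [hC])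
  refine ⟨fun h => ?_, hzero⟩
  obtain ⟨y, hy, z, hz, rfl⟩ := Submodule.mem_sup.1 hx
  rw [Matrix.add_vecMul, hzero hy, zero_add, ← hU.mem_hermDual_iff hz, hC] at h
  exact C.add_mem hy h

theorem dotProduct_star_of_mem_sup (hC : hermDual (hermDual C) = C)
    {U : Matrix (Fin k) (Fin n) F} {U' : Matrix (Fin c) (Fin n) F} (hU : IsOrthonormalBasis C U)
    (hU' : IsOrthonormalBasis (hermDual C) U') {x y : Fin n → F} (hx : x ∈ C ⊔ hermDual C)
    (hy : y ∈ C ⊔ hermDual C) :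
    x ⬝ᵥ star y = (x ᵥ* Uᴴ) ⬝ᵥ star (y ᵥ* Uᴴ) + (x ᵥ* U'ᴴ) ⬝ᵥ star (y ᵥ* U'ᴴ) := by
  obtain ⟨x₁, hx₁, x₂, hx₂, rfl⟩ := Submodule.mem_sup.1 hx
  obtain ⟨y₁, hy₁, y₂, hy₂, rfl⟩ := Submodule.mem_sup.1 hy
  have hU₂ {z} (hz : z ∈ hermDual C) : z ᵥ* Uᴴ = 0 := hU.vecMul_eq_zero hz
  have hU₁ {z} (hz : z ∈ C) : z ᵥ* U'ᴴ = 0 := hU'.vecMul_eq_zero (by rwa [hC])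
  rw [Matrix.add_vecMul, Matrix.add_vecMul, Matrix.add_vecMul, Matrix.add_vecMul, hU₂ hx₂, hU₂ hy₂,
    hU₁ hx₁, hU₁ hy₁, add_zero, add_zero, zero_add, zero_add, ← hU.dotProduct_star hx₁ hy₁,
    ← hU'.dotProduct_star hx₂ hy₂, star_add, add_dotProduct, dotProduct_add, dotProduct_add,
    hx₂ y₁ hy₁, dotProduct_star_eq_zero_comm.1 (hy₂ x₁ hx₁), add_zero, zero_add]

theorem mem_hermDual_of_forall_sq_eq_one (hψ : IsSymplectic (hermBicharacter ψ)) {e : Fin n → F}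
    (h : ∀ y ∈ C, piBicharacter (Fin n) (hermBicharacter ψ) e y ^ 2 = 1) : e ∈ hermDual C := by
  refine fun y hy => hψ.eq_zero_of_forall_mul fun a => ?_
  have hay := h (star a • y) (C.smul_mem _ hy)
  rwa [piBicharacter_hermBicharacter, star_smul, star_star, dotProduct_smul, smul_eq_mul] at hay

theorem existsEAQECC_of_isOrthonormalBasis [Finite F] {q : ℕ} (hcard : Nat.card F = q ^ 2)
    {w : F → Matrix (Fin q) (Fin q) ℂ} (hψ : IsSymplectic (hermBicharacter ψ))
    (hw : IsWeylSystem (hermBicharacter ψ) w) (hC : hermDual (hermDual C) = C)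
    {U : Matrix (Fin k) (Fin n) F} {U' : Matrix (Fin c) (Fin n) F} (hU : IsOrthonormalBasis C U)
    (hU' : IsOrthonormalBasis (hermDual C) U') [DecidableEq F] {d : ℕ}
    (hd : IsLeast {t | ∃ e ∈ C, e ∉ hermDual C ∧ hammingNorm e = t} d) :
    ExistsEAQECC q n k d c := by
  have : NeZero q := ⟨by rintro rfl; exact Nat.card_pos.ne' hcard⟩
  let f : ↥(C ⊔ hermDual C) →ₗ[F] (Fin k → F) × (Fin c → F) :=
    (Uᴴ.vecMulLinear.prod U'ᴴ.vecMulLinear) ∘ₗ (C ⊔ hermDual C).subtype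
  have hsnd (p) : (f p).2 = 0 ↔ (p : Fin n → F) ∈ C := vecMul_eq_zero_iff_mem hC hU' p.2
  refine existsEAQECC_of_weylSystem hψ hw hcard (a := (C ⊔ hermDual C).subtype.toAddMonoidHom)
    (b := f.toAddMonoidHom) Subtype.val_injective ?_ (fun p p' => ?_) (fun e he => ?_) ?_
  · rintro ⟨x, y⟩
    refine ⟨⟨x ᵥ* U + y ᵥ* U', Submodule.add_mem_sup (hU.vecMul_mem x) (hU'.vecMul_mem y)⟩,
      Prod.ext ?_ ?_⟩
    · change (x ᵥ* U + y ᵥ* U') ᵥ* Uᴴ = x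
      rw [Matrix.add_vecMul, hU.vecMul_vecMul, hU.vecMul_eq_zero (hU'.vecMul_mem y), add_zero]
    · change (x ᵥ* U + y ᵥ* U') ᵥ* U'ᴴ = y
      rw [Matrix.add_vecMul, hU'.vecMul_vecMul, hU'.vecMul_eq_zero, zero_add]
      exact hC.symm ▸ hU.vecMul_mem x
  · rw [prodBicharacter_apply, piBicharacter_hermBicharacter, piBicharacter_hermBicharacter,
      piBicharacter_hermBicharacter, ← AddChar.mul_apply, ← AddChar.map_add_eq_mul]
    exact congrArg (hermBicharacter ψ · 1) (dotProduct_star_of_mem_sup hC hU hU' p.2 p'.2)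
  · have heC : e ∈ C := hC ▸ mem_hermDual_of_forall_sq_eq_one hψ fun y hy =>
      he ⟨y, Submodule.mem_sup_right hy⟩ (hU.vecMul_eq_zero hy)
    exact ⟨⟨e, Submodule.mem_sup_left heC⟩, rfl, (hsnd _).2 heC⟩
  · convert hd using 1
    ext t
    constructor
    · rintro ⟨p, hp2, hp1, ht⟩
      exact ⟨p, (hsnd p).1 hp2, fun h => hp1 (hU.vecMul_eq_zero h), ht⟩
    · rintro ⟨e, he, he', ht⟩
      exact ⟨⟨e, Submodule.mem_sup_left he⟩, (hsnd _).2 he,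
        fun h => he' ((hU.mem_hermDual_iff he).2 h), ht⟩

theorem existsEAQECC_of_isParityCheck [Finite F] [DecidableEq F] {q m d : ℕ} {γ : F}
    (hcard : Nat.card F = q ^ 2) (h2 : (2 : F) ≠ 0) (hγ0 : γ ≠ 0) (hγ : star γ = -γ)
    {H : Matrix (Fin m) (Fin n) F} (hH : IsParityCheck H C) (hc : (H * Hᴴ).rank = c)
    (hk : k + 2 * m = n + c) (hk0 : k ≠ 0) (hd : HasMinDist C d)
    (hspan : C ≤ Submodule.span F {e | e ∈ C ∧ hammingNorm e = d}) :
    ExistsEAQECC q n k d c := by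
  obtain ⟨ψ, hψ, w, hw⟩ := exists_isWeylSystem hcard h2 hγ0 hγ
  obtain ⟨k', U, hU⟩ := exists_isOrthonormalBasis hγ0 hγ h2 C
  obtain ⟨c', U', hU'⟩ := exists_isOrthonormalBasis hγ0 hγ h2 (hermDual C)
  have hrank := hH.rank_add_finrank
  have hdim := hH.card_add_finrank
  have hdimC := hU.card_add_finrank
  have hdimD := hU'.card_add_finrank
  rw [hH.hermDual_hermDual, inf_comm, hH.finrank_hermDual, Fintype.card_fin] at hdimD
  rw [Fintype.card_fin] at hdimC
  obtain rfl : c' = c := by omega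
  obtain rfl : k' = k := by omega
  refine existsEAQECC_of_isOrthonormalBasis hcard hψ hw hH.hermDual_hermDual hU hU'
    (isLeast_hammingNorm_notMem hd hspan fun h => hk0 ?_)
  rw [inf_eq_left.2 h] at hdimC
  omega

end Construction

/-! ### Polynomial codes -/

section PolynomialCode

variable {F : Type*} [Field F] {n : ℕ} {α : F} {g : F[X]}

/-- `wordPoly` as a linear map. -/
def wordPolyLinearMap (n : ℕ) : (Fin n → F) →ₗ[F] F[X] :=
  (degreeLT F n).subtype ∘ₗ (degreeLTEquiv F n).symm

theorem wordPolyLinearMap_apply (c : Fin n → F) : wordPolyLinearMap n c = wordPoly c := by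
  simp [wordPolyLinearMap, degreeLTEquiv, wordPoly, C_mul_X_pow_eq_monomial]

theorem coeff_wordPoly (c : Fin n → F) (i : Fin n) : (wordPoly c).coeff i = c i := by
  rw [← wordPolyLinearMap_apply]
  exact congrFun ((degreeLTEquiv F n).apply_symm_apply c) i

theorem degree_wordPoly_lt (c : Fin n → F) : (wordPoly c).degree < n := by
  rw [← wordPolyLinearMap_apply]
  exact mem_degreeLT.1 ((degreeLTEquiv F n).symm c).2

theorem wordPoly_coeff {P : F[X]} (hP : P.degree < n) :
    wordPoly (fun i : Fin n => P.coeff i) = P := by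
  rw [← wordPolyLinearMap_apply]
  exact congrArg Subtype.val ((degreeLTEquiv F n).symm_apply_apply ⟨P, mem_degreeLT.2 hP⟩)

theorem aeval_wordPoly {K : Type*} [Field K] [Algebra F K] (c : Fin n → F) (x : K) :
    aeval x (wordPoly c) = ∑ t, algebraMap F K (c t) * x ^ (t : ℕ) := by
  simp [wordPoly]

theorem wordPoly_constaShift (c : Fin (n + 1) → F) :
    wordPoly (constaShift α c) =
      X * wordPoly c - C (c (Fin.last n)) * (X ^ (n + 1) - C α) := by
  have hzero : constaShift α c 0 = α * c (Fin.last n) := rfl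
  have hsucc (i : Fin n) : constaShift α c i.succ = c i.castSucc := rfl
  simp only [wordPoly, Fin.sum_univ_succ (n := n) (f := fun i => C (constaShift α c i) * _),
    Fin.sum_univ_castSucc (n := n) (f := fun i => C (c i) * _), hzero, hsucc, mul_add,
    Finset.mul_sum, Fin.val_zero, Fin.val_succ, Fin.val_castSucc, Fin.val_last, C_mul, pow_succ']
  simp only [mul_left_comm X]
  ring

/-- The polynomial code with generator `g`: the words of length `n` whose polynomial is divisible
by `g`. -/
def codeOf (n : ℕ) (g : F[X]) : Submodule F (Fin n → F) :=
  ((Ideal.span {g}).restrictScalars F).comap (wordPolyLinearMap n)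

theorem mem_codeOf {c : Fin n → F} : c ∈ codeOf n g ↔ g ∣ wordPoly c := by
  rw [← wordPolyLinearMap_apply, ← Ideal.mem_span_singleton]
  rfl

theorem isGeneratorPoly_iff {C' : Submodule F (Fin n → F)} :
    IsGeneratorPoly α C' g ↔ g.Monic ∧ g ∣ X ^ n - C α ∧ C' = codeOf n g := by
  refine and_congr_right fun _ => and_congr_right fun hd => ?_
  have hle : Ideal.span {X ^ n - C α} ≤ Ideal.span {g} :=
    Ideal.span_singleton_le_span_singleton.2 hd
  simp only [SetLike.ext_iff, mem_codeOf, ← Ideal.mem_span_singleton,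
    ← Ideal.mem_quotient_iff_mem hle, Ideal.map_span, Set.image_singleton]

theorem isConstacyclic_codeOf (hd : g ∣ X ^ n - C α) : IsConstacyclic α (codeOf n g) := by
  intro c hc
  cases n with
  | zero => rwa [Subsingleton.elim (constaShift α c) c]
  | succ n =>
    rw [mem_codeOf, wordPoly_constaShift]
    exact dvd_sub ((mem_codeOf.1 hc).mul_left _) (hd.mul_left _)

theorem finrank_codeOf (hg : g.Monic) (hn : g.natDegree ≤ n) :
    Module.finrank F (codeOf n g) + g.natDegree = n := by
  let f : (Fin n → F) →ₗ[F] F[X] ⧸ Ideal.span {g} :=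
    (Ideal.Quotient.mkₐ F (Ideal.span {g})).toLinearMap ∘ₗ wordPolyLinearMap n
  have hker : LinearMap.ker f = codeOf n g := by
    ext c
    rw [mem_codeOf, ← Ideal.mem_span_singleton, ← wordPolyLinearMap_apply]
    exact Ideal.Quotient.eq_zero_iff_mem
  have hrange : LinearMap.range f = ⊤ := by
    refine LinearMap.range_eq_top.2 fun y => ?_
    obtain ⟨p, rfl⟩ := Ideal.Quotient.mk_surjective y
    refine ⟨fun i => (p %ₘ g).coeff i, ?_⟩
    change Ideal.Quotient.mk _ (wordPolyLinearMap n _) = _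
    rw [wordPolyLinearMap_apply, wordPoly_coeff, Ideal.Quotient.eq, Ideal.mem_span_singleton,
      dvd_sub_comm]
    · exact ⟨p /ₘ g, sub_eq_of_eq_add' (modByMonic_add_div p g).symm⟩
    · refine (degree_modByMonic_lt p hg).trans_le ?_
      rw [degree_eq_natDegree hg.ne_zero]
      exact_mod_cast hn
  have hrank := LinearMap.finrank_range_add_finrank_ker f
  rw [hker, hrange, finrank_top, finrank_quotient_span_eq_natDegree' hg,
    Module.finrank_fin_fun] at hrank
  rw [add_comm, hrank]

/-- The word of the polynomial `X ^ i * g`. -/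
def shiftWord (n : ℕ) (g : F[X]) (i : ℕ) : Fin n → F := fun t => (X ^ i * g).coeff t

theorem codeOf_le_span_shiftWord (hg : g.Monic) :
    codeOf n g ≤ Submodule.span F {e | ∃ i, i + g.natDegree < n ∧ e = shiftWord n g i} := by
  intro c hc
  obtain ⟨h, hh⟩ := mem_codeOf.1 hc
  have hsum : c = ∑ i ∈ h.support, h.coeff i • shiftWord n g i := by
    ext t
    rw [← coeff_wordPoly c t, hh, Finset.sum_apply]
    nth_rw 1 [h.as_sum_support_C_mul_X_pow]
    simp only [Finset.mul_sum, finsetSum_coeff, shiftWord, Pi.smul_apply, smul_eq_mul,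
      ← coeff_C_mul]
    exact Finset.sum_congr rfl fun i _ => by ring_nf
  rw [hsum]
  refine Submodule.sum_mem _ fun i hi => Submodule.smul_mem _ _ (Submodule.subset_span ⟨i, ?_, rfl⟩)
  have h0 : h ≠ 0 := nonempty_support_iff.1 ⟨i, hi⟩
  have hdeg := degree_wordPoly_lt c
  rw [hh, degree_mul, degree_eq_natDegree hg.ne_zero, degree_eq_natDegree h0, ← Nat.cast_add,
    Nat.cast_lt] at hdeg
  have hile := le_natDegree_of_mem_supp i hi
  omega

theorem shiftWord_mem_codeOf (hg : g.Monic) {i : ℕ} (hi : i + g.natDegree < n) :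
    shiftWord n g i ∈ codeOf n g := by
  have hpoly : wordPoly (shiftWord n g i) = X ^ i * g := by
    refine wordPoly_coeff ?_
    rw [degree_mul, degree_X_pow, degree_eq_natDegree hg.ne_zero]
    exact_mod_cast hi
  rw [mem_codeOf, hpoly]
  exact dvd_mul_left _ _

theorem shiftWord_ne_zero (hg : g.Monic) {i : ℕ} (hi : i + g.natDegree < n) :
    shiftWord n g i ≠ 0 := by
  refine Function.ne_iff.2 ⟨⟨i + g.natDegree, hi⟩, ?_⟩
  simp [shiftWord, add_comm i, coeff_X_pow_mul, hg]

theorem hammingNorm_shiftWord_le [DecidableEq F] (g : F[X]) (i : ℕ) :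
    hammingNorm (shiftWord n g i) ≤ g.natDegree + 1 := by
  rw [hammingNorm, ← Finset.card_map Fin.valEmbedding]
  refine (Finset.card_le_card (t := Finset.Icc i (i + g.natDegree)) fun t ht => ?_).trans
    (by rw [Nat.card_Icc]; omega)
  obtain ⟨t, ht', rfl⟩ := Finset.mem_map.1 ht
  have hcoeff := (Finset.mem_filter.1 ht').2
  rw [shiftWord, coeff_X_pow_mul', ite_ne_right_iff] at hcoeff
  have hle := le_natDegree_of_ne_zero hcoeff.2
  rw [Finset.mem_Icc, Fin.valEmbedding_apply]
  omega

section MinDist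

variable [DecidableEq F] (hg : g.Monic) (hn : g.natDegree < n)
  (hmin : ∀ c ∈ codeOf n g, c ≠ 0 → g.natDegree + 1 ≤ hammingNorm c)
include hg hmin

theorem hammingNorm_shiftWord {i : ℕ} (hi : i + g.natDegree < n) :
    hammingNorm (shiftWord n g i) = g.natDegree + 1 :=
  (hammingNorm_shiftWord_le g i).antisymm
    (hmin _ (shiftWord_mem_codeOf hg hi) (shiftWord_ne_zero hg hi))

include hn in
theorem hasMinDist_codeOf : HasMinDist (codeOf n g) (g.natDegree + 1) := by
  have hi : 0 + g.natDegree < n := by rwa [zero_add]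
  refine ⟨⟨_, shiftWord_mem_codeOf hg hi, shiftWord_ne_zero hg hi,
    hammingNorm_shiftWord hg hmin hi⟩, ?_⟩
  rintro _ ⟨c, hc, hc0, rfl⟩
  exact hmin c hc hc0

theorem codeOf_le_span_hammingNorm_eq : codeOf n g ≤
    Submodule.span F {e | e ∈ codeOf n g ∧ hammingNorm e = g.natDegree + 1} := by
  refine (codeOf_le_span_shiftWord hg).trans (Submodule.span_mono ?_)
  rintro _ ⟨i, hi, rfl⟩
  exact ⟨shiftWord_mem_codeOf hg hi, hammingNorm_shiftWord hg hmin hi⟩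

end MinDist

theorem lt_hammingNorm_of_aeval_eq_zero [DecidableEq F] {K : Type*} [Field K] [Algebra F K]
    {η β : K} (hη : IsPrimitiveRoot η n) (hβ : β ≠ 0) {ℓ : ℕ} {c : Fin n → F} (hc0 : c ≠ 0)
    (hc : ∀ j < ℓ, aeval (β * η ^ j) (wordPoly c) = 0) : ℓ < hammingNorm c := by
  by_contra! hle
  let e := (Finset.univ.filter fun t => c t ≠ 0).equivFin.symm
  let v (t : Fin n) : K := algebraMap F K (c t) * β ^ (t : ℕ)
  have hη_inj : Function.Injective fun t => η ^ ((e t : Fin n) : ℕ) := fun t t' h =>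
    e.injective (Subtype.ext (Fin.ext (hη.pow_inj (e t).1.2 (e t').1.2 h)))
  have hv : (fun t => v (e t)) = 0 := by
    refine Matrix.eq_zero_of_forall_pow_sum_mul_pow_eq_zero hη_inj fun j => ?_
    calc ∑ t, v (e t) * (η ^ ((e t : Fin n) : ℕ)) ^ (j : ℕ)
      _ = ∑ t with c t ≠ 0, v t * (η ^ (t : ℕ)) ^ (j : ℕ) := by
        rw [e.sum_comp fun t => v t * (η ^ (t : ℕ)) ^ (j : ℕ), Finset.sum_coe_sort _ fun t =>
          v t * (η ^ (t : ℕ)) ^ (j : ℕ)]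
      _ = aeval (β * η ^ (j : ℕ)) (wordPoly c) := by
        have hsupp (t : Fin n) (_ : t ∈ Finset.univ) (ht : v t * (η ^ (t : ℕ)) ^ (j : ℕ) ≠ 0) :
            c t ≠ 0 := fun hct => ht (by simp [v, hct])
        rw [aeval_wordPoly, Finset.sum_filter_of_ne hsupp]
        exact Finset.sum_congr rfl fun t _ => by simp only [v]; ring
      _ = 0 := hc j (j.2.trans_le hle)
  obtain ⟨t, ht⟩ := Function.ne_iff.1 hc0
  have hvt := congrFun hv (e.symm ⟨t, by simpa using ht⟩)
  rw [e.apply_symm_apply] at hvt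
  exact mul_ne_zero ((_root_.map_ne_zero _).2 ht) (pow_ne_zero _ hβ) hvt

end PolynomialCode

/-! ### Defining sets -/

section RootsOfUnity

variable {K : Type*} [Field K] {N : ℕ} [NeZero N] {δ : K}

theorem pow_val_add (hδ : δ ^ N = 1) (i j : ZMod N) : δ ^ (i + j).val = δ ^ i.val * δ ^ j.val :=
  AddChar.map_add_eq_mul (AddChar.zmodChar N hδ) i j

theorem pow_val_natCast_mul (hδ : δ ^ N = 1) (a : ℕ) (i : ZMod N) :
    δ ^ ((a : ZMod N) * i).val = (δ ^ i.val) ^ a := by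
  rw [← nsmul_eq_mul]
  exact AddChar.map_nsmul_eq_pow (AddChar.zmodChar N hδ) a i

theorem pow_val_natCast (hδ : δ ^ N = 1) (a : ℕ) : δ ^ (a : ZMod N).val = δ ^ a :=
  AddChar.zmodChar_apply' hδ a

theorem pow_val_injective (hδ : IsPrimitiveRoot δ N) :
    Function.Injective fun i : ZMod N => δ ^ i.val := fun i j h =>
  ZMod.val_injective N (hδ.pow_inj i.val_lt j.val_lt h)

/-- The polynomial with the simple roots `δ ^ i`, `i ∈ Z`. -/
def rootProd (δ : K) (Z : Set (ZMod N)) : K[X] :=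
  ∏ i ∈ Z.toFinite.toFinset, (X - C (δ ^ i.val))

theorem monic_rootProd (δ : K) (Z : Set (ZMod N)) : (rootProd δ Z).Monic :=
  monic_prod_of_monic _ _ fun _ _ => monic_X_sub_C _

theorem natDegree_rootProd (δ : K) (Z : Set (ZMod N)) : (rootProd δ Z).natDegree = Z.ncard := by
  rw [rootProd, natDegree_prod_of_monic _ _ fun _ _ => monic_X_sub_C _,
    Set.ncard_eq_toFinset_card Z Z.toFinite]
  simp only [natDegree_X_sub_C, Finset.sum_const, smul_eq_mul, mul_one]

theorem isRoot_rootProd {Z : Set (ZMod N)} {x : K} :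
    (rootProd δ Z).IsRoot x ↔ ∃ i ∈ Z, x = δ ^ i.val := by
  simp [rootProd, IsRoot, eval_prod, Finset.prod_eq_zero_iff, sub_eq_zero]

theorem rootProd_dvd_iff (hδ : IsPrimitiveRoot δ N) {Z : Set (ZMod N)} {P : K[X]} :
    rootProd δ Z ∣ P ↔ ∀ i ∈ Z, P.IsRoot (δ ^ i.val) := by
  refine ⟨fun h i hi => (isRoot_rootProd.2 ⟨i, hi, rfl⟩).dvd h, fun h => ?_⟩
  refine Finset.prod_dvd_of_coprime (fun i _ j _ hij => ?_) fun i hi => ?_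
  · exact isCoprime_X_sub_C_of_isUnit_sub (sub_ne_zero.2 ((pow_val_injective hδ).ne hij)).isUnit
  · exact dvd_iff_isRoot.2 (h i (by simpa using hi))

theorem eq_rootProd (hδ : IsPrimitiveRoot δ N) {P : K[X]} (hP : P.Monic) (hPs : P.Separable)
    (hPsplits : P.Splits) {Z : Set (ZMod N)} (hZ : ∀ x, P.IsRoot x ↔ ∃ i ∈ Z, x = δ ^ i.val) :
    P = rootProd δ Z := by
  have hmonic := monic_rootProd δ Z
  refine eq_of_monic_of_associated hP hmonic (associated_of_dvd_dvd ?_ ?_)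
  · refine (hPsplits.dvd_iff_roots_le_roots hP.ne_zero hmonic.ne_zero).2
      ((Multiset.le_iff_subset (nodup_roots hPs)).2 fun x hx => ?_)
    rw [mem_roots hmonic.ne_zero, isRoot_rootProd, ← hZ]
    exact isRoot_of_mem_roots hx
  · exact (rootProd_dvd_iff hδ).2 fun i hi => (hZ _).2 ⟨i, hi, rfl⟩

theorem mem_range_algebraMap_of_pow_card_eq {F : Type*} [Field F] [Fintype F] [Algebra F K] {x : K}
    (hx : x ^ Fintype.card F = x) : x ∈ (algebraMap F K).range := by
  have hcard := Fintype.one_lt_card (α := F)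
  refine Splits.mem_range_of_isRoot (f := X ^ Fintype.card F - X) ?_
    (FiniteField.X_pow_card_sub_X_ne_zero F hcard) (by simp [hx])
  rw [splits_iff_card_roots, FiniteField.roots_X_pow_card_sub_X,
    FiniteField.X_pow_card_sub_X_natDegree_eq F hcard]
  exact Finset.card_univ

theorem natCast_mul_injective (hδ : IsPrimitiveRoot δ N) {a : ℕ} {φ : K →+* K}
    (hφ : ∀ x, φ x = x ^ a) : Function.Injective fun i : ZMod N => (a : ZMod N) * i := by
  intro i j h
  refine pow_val_injective hδ (φ.injective ?_)
  simpa only [hφ, pow_val_natCast_mul hδ.pow_eq_one] using congrArg (δ ^ ·.val) h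

theorem rootProd_mem_lifts {F : Type*} [Field F] [Fintype F] [Algebra F K]
    (hδ : IsPrimitiveRoot δ N) {Z : Set (ZMod N)}
    (hZ : ∀ i ∈ Z, (Fintype.card F : ZMod N) * i ∈ Z) :
    rootProd δ Z ∈ lifts (algebraMap F K) := by
  let φ := FiniteField.frobeniusAlgHom F K
  have hφ (i : ZMod N) : φ (δ ^ i.val) = δ ^ ((Fintype.card F : ZMod N) * i).val :=
    (pow_val_natCast_mul hδ.pow_eq_one _ i).symm
  have hinj := natCast_mul_injective hδ (φ := φ.toRingHom) fun _ => rfl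
  have himage : Z.toFinite.toFinset.image (fun i => (Fintype.card F : ZMod N) * i) =
      Z.toFinite.toFinset := by
    refine Finset.eq_of_subset_of_card_le (Finset.image_subset_iff.2 fun i hi => ?_)
      (Finset.card_image_of_injective _ hinj).ge
    simpa using hZ i (by simpa using hi)
  have hfix : (rootProd δ Z).map φ.toRingHom = rootProd δ Z := by
    nth_rw 2 [rootProd]
    rw [← himage, Finset.prod_image hinj.injOn, rootProd, Polynomial.map_prod]
    refine Finset.prod_congr rfl fun i _ => ?_
    rw [Polynomial.map_sub, map_X, map_C, ← hφ]
    rfl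
  rw [lifts_iff_coeff_lifts]
  intro t
  refine mem_range_algebraMap_of_pow_card_eq ?_
  nth_rw 2 [← hfix]
  rw [coeff_map]
  rfl

end RootsOfUnity

section ConstacyclicCode

variable {F K : Type*} [Field F] [Field K] [Algebra F K] {r n : ℕ} [NeZero (r * n)] {δ : K} {α : F}
  {g : F[X]} {C' : Submodule F (Fin n → F)} {Z : Set (ZMod (r * n))}

theorem mem_rootExponents_iff {i : ZMod (r * n)} :
    i ∈ rootExponents r n ↔ (n : ZMod (r * n)) * i = n := by
  have hrn : (n : ZMod (r * n)) * r = 0 := by rw [mul_comm, ← Nat.cast_mul, ZMod.natCast_self]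
  constructor
  · rintro ⟨j, -, rfl⟩
    linear_combination (j : ZMod (r * n)) * hrn
  · obtain ⟨a, rfl⟩ := ZMod.intCast_surjective i
    intro h
    have hn0 : n ≠ 0 := right_ne_zero_of_mul (NeZero.ne (r * n))
    have hdvd : ((r * n : ℕ) : ℤ) ∣ n * a - n := by
      rw [← ZMod.intCast_zmod_eq_zero_iff_dvd]
      push_cast
      rw [h, sub_self]
    rw [mul_comm r, Nat.cast_mul, ← mul_sub_one,
      mul_dvd_mul_iff_left (by exact_mod_cast hn0)] at hdvd
    obtain ⟨t, ht⟩ := hdvd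
    have hmod : 0 ≤ t % n ∧ t % n < n :=
      ⟨Int.emod_nonneg _ (by exact_mod_cast hn0), Int.emod_lt_of_pos _ (by omega)⟩
    refine ⟨(t % n).toNat, by omega, ?_⟩
    have ha : a = 1 + r * (t % n) + r * n * (t / n) := by
      linear_combination ht - r * Int.emod_add_mul_ediv t n
    rw [← Int.cast_natCast (t % n).toNat, Int.toNat_of_nonneg hmod.1, ha]
    push_cast
    linear_combination ((t / n : ℤ) : ZMod (r * n)) * hrn

theorem pow_val_pow_eq_iff (hδ : IsPrimitiveRoot δ (r * n)) {i : ZMod (r * n)} :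
    (δ ^ i.val) ^ n = δ ^ n ↔ i ∈ rootExponents r n := by
  rw [mem_rootExponents_iff, ← pow_val_natCast_mul hδ.pow_eq_one, ← pow_val_natCast hδ.pow_eq_one n,
    (pow_val_injective hδ).eq_iff]

theorem exists_eq_pow_val (hδ : IsPrimitiveRoot δ (r * n)) {x : K} (hx : x ^ n = δ ^ n) :
    ∃ i ∈ rootExponents r n, x = δ ^ i.val := by
  have hx1 : x ^ (r * n) = 1 := by
    rw [mul_comm, pow_mul, hx, ← pow_mul, mul_comm, hδ.pow_eq_one]
  obtain ⟨a, -, rfl⟩ := hδ.eq_pow_of_pow_eq_one hx1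
  rw [← pow_val_natCast hδ.pow_eq_one] at hx ⊢
  exact ⟨a, (pow_val_pow_eq_iff hδ).1 hx, rfl⟩

theorem map_eq_rootProd (hδ : IsPrimitiveRoot δ (r * n)) (hδα : δ ^ n = algebraMap F K α)
    (hn : (n : F) ≠ 0) (hg : g.Monic) (hd : g ∣ X ^ n - C α) :
    g.map (algebraMap F K) = rootProd δ (rootSet r n δ g) := by
  have hα : α ≠ 0 := by
    rintro rfl
    rw [map_zero] at hδα
    exact pow_ne_zero n (hδ.ne_zero (NeZero.ne _)) hδα
  have hd' : g.map (algebraMap F K) ∣ X ^ n - C (algebraMap F K α) := by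
    simpa using Polynomial.map_dvd (algebraMap F K) hd
  have hη : IsPrimitiveRoot (δ ^ r) n := hδ.pow (NeZero.pos _) rfl
  have hn0 : 0 < n := Nat.pos_of_ne_zero (right_ne_zero_of_mul (NeZero.ne (r * n)))
  refine eq_rootProd hδ (hg.map _) ((separable_X_pow_sub_C α hn hα).of_dvd hd).map
    ((X_pow_sub_C_splits_of_isPrimitiveRoot hη hδα).of_dvd (X_pow_sub_C_ne_zero hn0 _) hd')
    fun x => ?_
  rw [IsRoot, eval_map_algebraMap]
  constructor
  · intro hx
    have hxn : x ^ n = δ ^ n := by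
      have hroot := IsRoot.dvd (x := x) (by rwa [IsRoot, eval_map_algebraMap]) hd'
      simpa [IsRoot, sub_eq_zero, hδα] using hroot
    obtain ⟨i, hi, rfl⟩ := exists_eq_pow_val hδ hxn
    exact ⟨i, ⟨hi, hx⟩, rfl⟩
  · rintro ⟨i, hi, rfl⟩
    exact hi.2

section MapEq

variable (hδ : IsPrimitiveRoot δ (r * n)) (hg : g.map (algebraMap F K) = rootProd δ Z)
include hδ hg

theorem dvd_iff_of_map_eq_rootProd {P : F[X]} :
    g ∣ P ↔ ∀ i ∈ Z, aeval (δ ^ i.val) P = 0 := by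
  rw [← map_dvd_map' (algebraMap F K), hg, rootProd_dvd_iff hδ]
  simp only [IsRoot, eval_map_algebraMap]

theorem dvd_X_pow_sub_C_of_map_eq_rootProd (hδα : δ ^ n = algebraMap F K α)
    (hZ : Z ⊆ rootExponents r n) : g ∣ X ^ n - C α := by
  refine (dvd_iff_of_map_eq_rootProd hδ hg).2 fun i hi => ?_
  simp [(pow_val_pow_eq_iff hδ).2 (hZ hi), hδα]

theorem rootSet_of_map_eq_rootProd (hZ : Z ⊆ rootExponents r n) : rootSet r n δ g = Z := by
  have hroot (i : ZMod (r * n)) : aeval (δ ^ i.val) g = 0 ↔ i ∈ Z := by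
    rw [← eval_map_algebraMap, hg, ← IsRoot, isRoot_rootProd]
    exact ⟨fun ⟨j, hj, hij⟩ => pow_val_injective hδ hij ▸ hj, fun hi => ⟨i, hi, rfl⟩⟩
  ext i
  exact ⟨fun hi => (hroot i).1 hi.2, fun hi => ⟨hZ hi, (hroot i).2 hi⟩⟩

end MapEq

theorem isConstacyclicWithDefiningSet_iff (hδ : IsPrimitiveRoot δ (r * n))
    (hδα : δ ^ n = algebraMap F K α) (hn : (n : F) ≠ 0) :
    IsConstacyclicWithDefiningSet r n δ α C' Z ↔
      Z ⊆ rootExponents r n ∧ ∃ g : F[X], g.map (algebraMap F K) = rootProd δ Z ∧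
        C' = codeOf n g := by
  constructor
  · rintro ⟨-, g, hg, rfl⟩
    obtain ⟨hmonic, hd, rfl⟩ := isGeneratorPoly_iff.1 hg
    exact ⟨fun i hi => hi.1, g, map_eq_rootProd hδ hδα hn hmonic hd, rfl⟩
  · rintro ⟨hZ, g, hg, rfl⟩
    have hmonic : g.Monic := monic_of_injective (algebraMap F K).injective
      (hg ▸ monic_rootProd δ Z)
    have hd := dvd_X_pow_sub_C_of_map_eq_rootProd hδ hg hδα hZ
    exact ⟨isConstacyclic_codeOf hd, g, isGeneratorPoly_iff.2 ⟨hmonic, hd, rfl⟩,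
      rootSet_of_map_eq_rootProd hδ hg hZ⟩

theorem exists_isConstacyclicWithDefiningSet [Fintype F] (hδ : IsPrimitiveRoot δ (r * n))
    (hδα : δ ^ n = algebraMap F K α) (hn : (n : F) ≠ 0) (hZ : Z ⊆ rootExponents r n)
    (hZF : ∀ i ∈ Z, (Fintype.card F : ZMod (r * n)) * i ∈ Z) :
    ∃ C' : Submodule F (Fin n → F), IsConstacyclicWithDefiningSet r n δ α C' Z := by
  obtain ⟨g, hg⟩ := (mem_lifts _).1 (rootProd_mem_lifts hδ hZF)
  exact ⟨_, (isConstacyclicWithDefiningSet_iff hδ hδα hn).2 ⟨hZ, g, hg, rfl⟩⟩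

end ConstacyclicCode

namespace IsConstacyclicWithDefiningSet

variable {F K : Type*} [Field F] [Field K] [Algebra F K] {r n : ℕ} [NeZero (r * n)] {δ : K} {α : F}
  {C' : Submodule F (Fin n → F)} {Z : Set (ZMod (r * n))} (hδ : IsPrimitiveRoot δ (r * n))
  (hδα : δ ^ n = algebraMap F K α) (hn : (n : F) ≠ 0)
  (hC : IsConstacyclicWithDefiningSet r n δ α C' Z)
include hδ hδα hn hC

theorem exists_monic : ∃ g : F[X], g.Monic ∧ g.natDegree = Z.ncard ∧
    g.map (algebraMap F K) = rootProd δ Z ∧ C' = codeOf n g := by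
  obtain ⟨-, g, hg, rfl⟩ := (isConstacyclicWithDefiningSet_iff hδ hδα hn).1 hC
  refine ⟨g, monic_of_injective (algebraMap F K).injective (hg ▸ monic_rootProd δ Z), ?_, hg, rfl⟩
  rw [← natDegree_rootProd δ, ← hg, natDegree_map]

theorem mem_iff {c : Fin n → F} : c ∈ C' ↔ ∀ i ∈ Z, aeval (δ ^ i.val) (wordPoly c) = 0 := by
  obtain ⟨g, -, -, hg, rfl⟩ := hC.exists_monic hδ hδα hn
  rw [mem_codeOf, dvd_iff_of_map_eq_rootProd hδ hg]

theorem ncard_le : Z.ncard ≤ n := by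
  obtain ⟨hZ, g, hg, rfl⟩ := (isConstacyclicWithDefiningSet_iff hδ hδα hn).1 hC
  have hn0 : 0 < n := Nat.pos_of_ne_zero (right_ne_zero_of_mul (NeZero.ne (r * n)))
  rw [← natDegree_rootProd δ, ← hg, natDegree_map, ← natDegree_X_pow_sub_C (n := n) (r := α)]
  exact natDegree_le_of_dvd (dvd_X_pow_sub_C_of_map_eq_rootProd hδ hg hδα hZ)
    (X_pow_sub_C_ne_zero hn0 α)

theorem finrank_add_ncard : Module.finrank F C' + Z.ncard = n := by
  have hle := hC.ncard_le hδ hδα hn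
  obtain ⟨g, hmonic, hdeg, -, rfl⟩ := hC.exists_monic hδ hδα hn
  rw [← hdeg] at hle ⊢
  exact finrank_codeOf hmonic hle

section Consecutive

variable [DecidableEq F] {a : ZMod (r * n)} (hZ : ∀ j < Z.ncard, a + r * j ∈ Z)
include hZ

theorem ncard_lt_hammingNorm {c : Fin n → F} (hc : c ∈ C') (hc0 : c ≠ 0) :
    Z.ncard < hammingNorm c := by
  have hη : IsPrimitiveRoot (δ ^ r) n := hδ.pow (NeZero.pos _) rfl
  refine lt_hammingNorm_of_aeval_eq_zero hη (pow_ne_zero a.val (hδ.ne_zero (NeZero.ne _))) hc0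
    fun j hj => ?_
  have hroot := (hC.mem_iff hδ hδα hn).1 hc _ (hZ j hj)
  rwa [pow_val_add hδ.pow_eq_one, ← Nat.cast_mul, pow_val_natCast hδ.pow_eq_one, pow_mul] at hroot

theorem hasMinDist (hlt : Z.ncard < n) : HasMinDist C' (Z.ncard + 1) := by
  have hmin := fun c => hC.ncard_lt_hammingNorm hδ hδα hn hZ (c := c)
  obtain ⟨g, hmonic, hdeg, -, rfl⟩ := hC.exists_monic hδ hδα hn
  rw [← hdeg] at hlt hmin ⊢
  exact hasMinDist_codeOf hmonic hlt hmin

theorem le_span_hammingNorm_eq :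
    C' ≤ Submodule.span F {e | e ∈ C' ∧ hammingNorm e = Z.ncard + 1} := by
  have hmin := fun c => hC.ncard_lt_hammingNorm hδ hδα hn hZ (c := c)
  obtain ⟨g, hmonic, hdeg, -, rfl⟩ := hC.exists_monic hδ hδα hn
  rw [← hdeg] at hmin ⊢
  exact codeOf_le_span_hammingNorm_eq hmonic hmin

end Consecutive

end IsConstacyclicWithDefiningSet

/-! ### The rank of `H Hᴴ` -/

section Rank

variable {F K : Type*} [Field F] [Field K] {ι κ : Type*} [Fintype κ]

theorem rank_eq_card_of_mul_mul_eq_one [Fintype ι] [DecidableEq ι] {m : Type*} [Fintype m]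
    {Q : Matrix m ι F} {P : Matrix ι κ F} {L : Matrix ι m F} {R : Matrix κ ι F} (hL : L * Q = 1)
    (hR : P * R = 1) : (Q * P).rank = Fintype.card ι := by
  refine le_antisymm ((Matrix.rank_mul_le_left Q P).trans Q.rank_le_card_width) ?_
  have hone : L * (Q * P * R) = 1 := by rw [Matrix.mul_assoc, hR, Matrix.mul_one, hL]
  rw [← Matrix.rank_one (R := F) (n := ι), ← hone]
  exact (Matrix.rank_mul_le_right _ _).trans (Matrix.rank_mul_le_left _ _)

theorem exists_rank_factorization [Fintype ι] (M : Matrix ι κ F) :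
    ∃ (k : ℕ) (Q : Matrix ι (Fin k) F) (P : Matrix (Fin k) κ F), Q * P = M ∧
      (∃ L : Matrix (Fin k) ι F, L * Q = 1) ∧ ∃ R : Matrix κ (Fin k) F, P * R = 1 := by
  classical
  let e := (Module.finBasis F (LinearMap.range M.mulVecLin)).equivFun
  let incl := (LinearMap.range M.mulVecLin).subtype ∘ₗ e.symm.toLinearMap
  let proj := e.toLinearMap ∘ₗ M.mulVecLin.rangeRestrict
  have hcomp : incl ∘ₗ proj = Matrix.toLin' M := by
    ext
    simp [incl, proj]
  obtain ⟨ret, hret⟩ := incl.exists_leftInverse_of_injective <| LinearMap.ker_eq_bot.2 <|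
    (Submodule.subtype_injective _).comp e.symm.injective
  obtain ⟨sec, hsec⟩ := proj.exists_rightInverse_of_surjective <| LinearMap.range_eq_top.2 <|
    e.surjective.comp M.mulVecLin.surjective_rangeRestrict
  refine ⟨_, incl.toMatrix', proj.toMatrix', ?_, ⟨ret.toMatrix', ?_⟩, ⟨sec.toMatrix', ?_⟩⟩
  · rw [← LinearMap.toMatrix'_comp, hcomp, LinearMap.toMatrix'_toLin']
  · exact by rw [← LinearMap.toMatrix'_comp, hret, LinearMap.toMatrix'_id]
  · exact by rw [← LinearMap.toMatrix'_comp, hsec, LinearMap.toMatrix'_id]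

theorem rank_map [Finite ι] (f : F →+* K) (M : Matrix ι κ F) : (M.map f).rank = M.rank := by
  have := Fintype.ofFinite ι
  obtain ⟨k, Q, P, rfl, ⟨L, hL⟩, R, hR⟩ := exists_rank_factorization M
  have hL' : L.map f * Q.map f = 1 := by
    rw [← Matrix.map_mul, hL, Matrix.map_one f f.map_zero f.map_one]
  have hR' : P.map f * R.map f = 1 := by
    rw [← Matrix.map_mul, hR, Matrix.map_one f f.map_zero f.map_one]
  rw [Matrix.map_mul, rank_eq_card_of_mul_mul_eq_one hL' hR', rank_eq_card_of_mul_mul_eq_one hL hR]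

theorem rank_of_ite_eq [Finite ι] {β : Type*} [DecidableEq β] {u : ι → β} {v : κ → β}
    (hu : Function.Injective u) (hv : Function.Injective v) {ν : K} (hν : ν ≠ 0) :
    (Matrix.of fun i j => if u i = v j then ν else 0).rank =
      (Set.range u ∩ Set.range v).ncard := by
  classical
  have := Fintype.ofFinite ι
  let M : Matrix ι κ K := Matrix.of fun i j => if u i = v j then ν else 0
  let w (i : ι) : K := if u i ∈ Set.range v then ν ^ 2 else 0
  have hMM : M * Mᵀ = Matrix.diagonal w := by
    ext i i'
    simp only [Matrix.mul_apply, Matrix.transpose_apply, Matrix.diagonal_apply, M, w,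
      Matrix.of_apply]
    by_cases hi : u i ∈ Set.range v
    · rw [if_pos hi]
      obtain ⟨j, hj⟩ := hi
      simp only [← hj, hv.eq_iff, ite_mul, zero_mul, Finset.sum_ite_eq, Finset.mem_univ, if_true]
      simp [hj, hu.eq_iff, sq, eq_comm (a := i)]
    · have hne (j : κ) : u i ≠ v j := fun h => hi ⟨j, h.symm⟩
      simp [hi, hne]
  have hM : Matrix.diagonal w * (ν⁻¹ ^ 2 • M) = M := by
    ext i j
    rw [Matrix.diagonal_mul]
    by_cases hij : u i = v j
    · simp [M, w, hij, hν]
    · simp [M, hij]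
  have hrank : M.rank = (Matrix.diagonal w).rank := by
    refine le_antisymm ?_ (hMM ▸ Matrix.rank_mul_le_left _ _)
    nth_rw 1 [← hM]
    exact Matrix.rank_mul_le_left _ _
  have hw (i : ι) : w i ≠ 0 ↔ u i ∈ Set.range v := by
    simp [w, hν]
  rw [hrank, Matrix.rank_diagonal, ← Nat.card_eq_fintype_card, ← Set.image_preimage_eq_range_inter,
    Set.ncard_image_of_injective _ hu]
  exact Nat.card_congr (Equiv.subtypeEquivRight hw)

theorem sum_pow_eq_ite {n : ℕ} [DecidableEq K] {x : K} (hx : x ^ n = 1) :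
    ∑ t : Fin n, x ^ (t : ℕ) = if x = 1 then (n : K) else 0 := by
  rw [Fin.sum_univ_eq_sum_range fun t => x ^ t]
  split_ifs with h
  · simp [h]
  · refine (mul_eq_zero.1 ?_).resolve_right (sub_ne_zero.2 h)
    rw [geom_sum_mul, hx, sub_self]

theorem rank_mul_map_transpose_le (φ : K →+* K) [Fintype ι] {m : Type*} [Fintype m]
    {V : Matrix m κ K} {A : Matrix m ι K} {W : Matrix ι κ K} (hV : V = A * W) :
    (V * (V.map φ)ᵀ).rank ≤ (W * (W.map φ)ᵀ).rank := by
  have hgram : V * (V.map φ)ᵀ = A * (W * (W.map φ)ᵀ * (A.map φ)ᵀ) := by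
    rw [hV, Matrix.map_mul, Matrix.transpose_mul]
    simp only [Matrix.mul_assoc]
  rw [hgram]
  exact (Matrix.rank_mul_le_right _ _).trans (Matrix.rank_mul_le_left _ _)

theorem eq_mul_mul_of_mul_eq_one [Fintype ι] [DecidableEq ι] {m : Type*} [Fintype m] (e : ι ≃ m)
    {V : Matrix ι κ K} {A : Matrix ι m K} {U : Matrix m κ K} {W : Matrix κ ι K} (hV : V = A * U)
    (hW : V * W = 1) : U = U * W * V := by
  classical
  have hleft : A * (U * W) = 1 := by rw [← Matrix.mul_assoc, ← hV, hW]
  have hright : U * W * A = 1 := (Matrix.mul_eq_one_comm_of_equiv e).1 hleft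
  rw [hV, ← Matrix.mul_assoc, hright, Matrix.one_mul]

end Rank

section ParityCheck

variable {F K : Type*} [Field F] [Field K] [Algebra F K] {q r n : ℕ} {δ : K} {α : F}
  {C' : Submodule F (Fin n → F)} {Z : Set (ZMod (r * n))}

/-- The matrix whose row `i ∈ Z` lists the powers of `δ ^ i`; the code with defining set `Z`
consists of the words over `F` in its kernel. -/
def powMatrix (δ : K) (Z : Set (ZMod (r * n))) : Matrix Z (Fin n) K :=
  Matrix.of fun i t => (δ ^ (i : ZMod (r * n)).val) ^ (t : ℕ)

theorem powMatrix_mulVec (c : Fin n → F) (i : Z) : (powMatrix δ Z *ᵥ (algebraMap F K ∘ c)) i =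
    aeval (δ ^ (i : ZMod (r * n)).val) (wordPoly c) := by
  simp only [aeval_wordPoly, Matrix.mulVec_apply_eq_sum, powMatrix, Matrix.of_apply, Function.comp,
    mul_comm]

variable [NeZero (r * n)]

theorem sum_powMatrix_mul_pow [DecidableEq K] (hδ : IsPrimitiveRoot δ (r * n))
    (hZ : Z ⊆ rootExponents r n) (i : Z) {y : K} (hy : y ^ n = (δ ^ n)⁻¹) :
    ∑ t : Fin n, powMatrix δ Z i t * y ^ (t : ℕ) =
      if δ ^ (i : ZMod (r * n)).val * y = 1 then (n : K) else 0 := by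
  rw [← sum_pow_eq_ite]
  · exact Finset.sum_congr rfl fun t _ => (mul_pow _ _ _).symm
  · rw [mul_pow, (pow_val_pow_eq_iff hδ).2 (hZ i.2), hy,
      mul_inv_cancel₀ (pow_ne_zero n (hδ.ne_zero (NeZero.ne _)))]

theorem rank_powMatrix_mul [Fintype Z] (hδ : IsPrimitiveRoot δ (r * n)) (hn : (n : K) ≠ 0)
    (hr : r ∣ q + 1) {φ : K →+* K} (hφ : ∀ x, φ x = x ^ q) (hZ : Z ⊆ rootExponents r n) :
    (powMatrix δ Z * ((powMatrix δ Z).map φ)ᵀ).rank = (Z ∩ negMul q (r * n) Z).ncard := by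
  classical
  let v (j : Z) : ZMod (r * n) := -(q : ZMod (r * n)) * j
  have hv : Function.Injective v := fun i j hij => Subtype.ext <|
    natCast_mul_injective hδ hφ (neg_injective (by simpa only [v, neg_mul] using hij))
  have hgram : powMatrix δ Z * ((powMatrix δ Z).map φ)ᵀ =
      Matrix.of fun i j : Z => if (i : ZMod (r * n)) = v j then (n : K) else 0 := by
    ext i j
    have hδq : δ ^ n * (δ ^ n) ^ q = 1 := by
      rw [← pow_succ', ← pow_mul, mul_comm]
      exact (hδ.pow_eq_one_iff_dvd _).2 (Nat.mul_dvd_mul_right hr n)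
    have hy : (δ ^ ((q : ZMod (r * n)) * j).val) ^ n = (δ ^ n)⁻¹ := by
      rw [pow_val_natCast_mul hδ.pow_eq_one, pow_right_comm, (pow_val_pow_eq_iff hδ).2 (hZ j.2)]
      exact eq_inv_of_mul_eq_one_right hδq
    have hiff : δ ^ (i : ZMod (r * n)).val * δ ^ ((q : ZMod (r * n)) * j).val = 1 ↔
        (i : ZMod (r * n)) = v j := by
      rw [← pow_val_add hδ.pow_eq_one, hδ.pow_eq_one_iff_dvd, ← ZMod.natCast_eq_zero_iff,
        ZMod.natCast_zmod_val, add_eq_zero_iff_eq_neg]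
      simp only [v, neg_mul]
    have hsum := sum_powMatrix_mul_pow hδ hZ i hy
    simp only [hiff] at hsum
    rw [Matrix.of_apply, ← hsum, Matrix.mul_apply]
    refine Finset.sum_congr rfl fun t _ => congrArg _ ?_
    rw [pow_val_natCast_mul hδ.pow_eq_one, pow_right_comm, ← hφ]
    rfl
  rw [hgram, rank_of_ite_eq Subtype.val_injective hv hn, Subtype.range_coe]
  congr 2
  ext x
  simp [negMul, v, eq_comm]

theorem exists_powMatrix_mul_eq_one [DecidableEq Z] (hδ : IsPrimitiveRoot δ (r * n))
    (hn : (n : K) ≠ 0) (hZ : Z ⊆ rootExponents r n) :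
    ∃ W : Matrix (Fin n) Z K, powMatrix δ Z * W = 1 := by
  classical
  let W : Matrix (Fin n) Z K :=
    Matrix.of fun t i => (n : K)⁻¹ * (δ ^ (i : ZMod (r * n)).val)⁻¹ ^ (t : ℕ)
  refine ⟨W, ?_⟩
  ext i j
  have hδ0 : δ ^ (j : ZMod (r * n)).val ≠ 0 := pow_ne_zero _ (hδ.ne_zero (NeZero.ne _))
  have hy : (δ ^ (j : ZMod (r * n)).val)⁻¹ ^ n = (δ ^ n)⁻¹ := by
    rw [inv_pow, (pow_val_pow_eq_iff hδ).2 (hZ j.2)]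
  have hsum := sum_powMatrix_mul_pow hδ hZ i hy
  simp only [mul_inv_eq_one₀ hδ0, (pow_val_injective hδ).eq_iff, Subtype.coe_inj] at hsum
  simp only [Matrix.mul_apply, W, Matrix.of_apply, mul_left_comm _ (n : K)⁻¹, ← Finset.mul_sum,
    hsum, Matrix.one_apply, mul_ite, inv_mul_cancel₀ hn, mul_zero]

namespace IsConstacyclicWithDefiningSet

theorem rank_mul_conjTransposeQ (hδ : IsPrimitiveRoot δ (r * n)) (hδα : δ ^ n = algebraMap F K α)
    (hn : (n : F) ≠ 0) (hC : IsConstacyclicWithDefiningSet r n δ α C' Z) (hr : r ∣ q + 1)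
    {φ : K →+* K} (hφ : ∀ x, φ x = x ^ q) {m : ℕ} {H : Matrix (Fin m) (Fin n) F}
    (hH : IsParityCheck H C') :
    (H * conjTransposeQ q H).rank = (Z ∩ negMul q (r * n) Z).ncard := by
  classical
  have := Fintype.ofFinite Z
  let f := algebraMap F K
  have hZ : Z ⊆ rootExponents r n := ((isConstacyclicWithDefiningSet_iff hδ hδα hn).1 hC).1
  have hnK : (n : K) ≠ 0 := by
    rw [← map_natCast f]
    exact (_root_.map_ne_zero f).2 hn
  obtain ⟨B, hB⟩ := hH.exists_right_inverse
  obtain ⟨W, hW⟩ := exists_powMatrix_mul_eq_one hδ hnK hZ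
  have hker : powMatrix δ Z * (1 - B * H).map f = 0 := by
    ext i t
    have hmem : (1 - B * H).col t ∈ C' := by
      refine (hH.2 _).2 (funext fun i => congrFun (congrFun (?_ : H * (1 - B * H) = 0) i) t)
      rw [Matrix.mul_sub, ← Matrix.mul_assoc, hB, Matrix.one_mul, Matrix.mul_one, sub_self]
    exact (powMatrix_mulVec _ i).trans ((hC.mem_iff hδ hδα hn).1 hmem i i.2)
  have hV : powMatrix δ Z = powMatrix δ Z * B.map f * H.map f := by
    rwa [Matrix.map_sub _ f.map_sub, Matrix.map_one _ f.map_zero f.map_one, Matrix.map_mul,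
      Matrix.mul_sub, Matrix.mul_one, ← Matrix.mul_assoc, sub_eq_zero] at hker
  have hcard : Nat.card Z = Nat.card (Fin m) := by
    have hdim := hC.finrank_add_ncard hδ hδα hn
    have hdim' := hH.card_add_finrank
    rw [Nat.card_coe_set_eq, Nat.card_fin]
    omega
  have hHV := eq_mul_mul_of_mul_eq_one (Finite.card_eq.1 hcard).some hV hW
  rw [← rank_powMatrix_mul hδ hnK hr hφ hZ, ← rank_map f]
  have hmap : (H * conjTransposeQ q H).map f = H.map f * ((H.map f).map φ)ᵀ := by
    ext i j
    simp [Matrix.mul_apply, conjTransposeQ, hφ]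
  rw [hmap]
  exact (rank_mul_map_transpose_le φ hHV).antisymm (rank_mul_map_transpose_le φ hV)

end IsConstacyclicWithDefiningSet

end ParityCheck

/-! ### The field of order `q ^ 2` -/

section Frobenius

variable {F : Type*} [Field F] {q : ℕ}

theorem exists_ringHom_eq_pow (hq : IsPrimePow q) (hF : (q : F) = 0) :
    ∃ φ : F →+* F, ∀ x, φ x = x ^ q := by
  obtain ⟨p, k, hp, -, rfl⟩ := hq
  rw [Nat.cast_pow] at hF
  have := Fact.mk hp.nat_prime
  have : CharP F p := (CharP.charP_iff_prime_eq_zero hp.nat_prime).2 (eq_zero_of_pow_eq_zero hF)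
  exact ⟨iterateFrobenius F p k, iterateFrobenius_def p k⟩

/-- An involutive ring endomorphism of a commutative ring as a star structure; used for the
conjugation `x ↦ x ^ q` of the field of order `q ^ 2`. -/
abbrev starRingOfInvolutive (φ : F →+* F) (hφ : Function.Involutive φ) : StarRing F where
  star := φ
  star_involutive := hφ
  star_mul x y := by rw [map_mul, mul_comm]
  star_add := map_add φ

variable [Fintype F] (hF : Fintype.card F = q ^ 2)
include hF

theorem natCast_eq_zero_of_card : (q : F) = 0 := by
  have hcard : ((q ^ 2 : ℕ) : F) = 0 := by rw [← hF, Nat.cast_card_eq_zero]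
  rw [Nat.cast_pow] at hcard
  exact pow_eq_zero_iff two_ne_zero |>.1 hcard

theorem natCast_ne_zero_of_dvd {a : ℕ} (ha : a ∣ q ^ 2 + 1) : (a : F) ≠ 0 := by
  obtain ⟨b, hb⟩ := ha
  intro h
  have hone : ((q ^ 2 + 1 : ℕ) : F) = 0 := by rw [hb, Nat.cast_mul, h, zero_mul]
  simp [natCast_eq_zero_of_card hF] at hone

theorem IsConstacyclicWithDefiningSet.rank_mul_conjTransposeQ_of_card {K : Type*} [Field K]
    [Algebra F K] {n r m : ℕ} [NeZero (r * n)] {α : F} {δ : K} {C' : Submodule F (Fin n → F)}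
    {Z : Set (ZMod (r * n))} (hq : IsPrimePow q) (hδ : IsPrimitiveRoot δ (r * n))
    (hδα : δ ^ n = algebraMap F K α) (hn : (n : F) ≠ 0) (hr : r ∣ q + 1)
    (hC : IsConstacyclicWithDefiningSet r n δ α C' Z) {H : Matrix (Fin m) (Fin n) F}
    (hH : IsParityCheck H C') :
    (H * conjTransposeQ q H).rank = (Z ∩ negMul q (r * n) Z).ncard := by
  obtain ⟨φ, hφ⟩ : ∃ φ : K →+* K, ∀ x, φ x = x ^ q := exists_ringHom_eq_pow hq <| by
    rw [← map_natCast (algebraMap F K), natCast_eq_zero_of_card hF, map_zero]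
  exact hC.rank_mul_conjTransposeQ hδ hδα hn hr hφ hH

theorem IsConstacyclicWithDefiningSet.existsEAQECC {K : Type*} [Field K] [Algebra F K]
    {n k : ℕ} [NeZero ((q + 1) * n)] {α : F} {δ : K} {C' : Submodule F (Fin n → F)}
    {Z : Set (ZMod ((q + 1) * n))} (hq : IsPrimePow q) (h2 : (2 : F) ≠ 0)
    (hα : IsPrimitiveRoot α (q + 1)) (hδ : IsPrimitiveRoot δ ((q + 1) * n))
    (hδα : δ ^ n = algebraMap F K α) (hn : (n : F) ≠ 0)
    (hC : IsConstacyclicWithDefiningSet (q + 1) n δ α C' Z) {a : ZMod ((q + 1) * n)}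
    (hZ : ∀ j < Z.ncard, a + (q + 1 : ℕ) * j ∈ Z) (hlt : Z.ncard < n) (hk0 : k ≠ 0)
    (hk : k + 2 * Z.ncard = n + (Z ∩ negMul q ((q + 1) * n) Z).ncard) :
    ExistsEAQECC q n k (Z.ncard + 1) (Z ∩ negMul q ((q + 1) * n) Z).ncard := by
  classical
  obtain ⟨φ, hφ⟩ := exists_ringHom_eq_pow hq (natCast_eq_zero_of_card hF)
  let : StarRing F := starRingOfInvolutive φ fun x => by
    rw [hφ, hφ, ← pow_mul, ← sq, ← hF, FiniteField.pow_card]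
  have hstar (x : F) : star x = x ^ q := hφ x
  obtain ⟨m, H, hH⟩ := exists_isParityCheck C'
  have hHH : Hᴴ = conjTransposeQ q H := Matrix.ext fun i j => hstar _
  have hα0 : α ≠ 0 := hα.ne_zero q.succ_ne_zero
  have hαq : star α = α⁻¹ := by
    rw [hstar]
    exact eq_inv_of_mul_eq_one_left (by rw [← pow_succ, hα.pow_eq_one])
  have hγ0 : α - α⁻¹ ≠ 0 := fun h => by
    have hα2 : α ^ 2 = 1 := by rw [sq, ← mul_inv_cancel₀ hα0, ← sub_eq_zero.1 h]
    have := Nat.le_of_dvd two_pos ((hα.pow_eq_one_iff_dvd 2).1 hα2)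
    have := hq.two_le
    omega
  have hdim := hC.finrank_add_ncard hδ hδα hn
  have hdim' := hH.card_add_finrank
  refine existsEAQECC_of_isParityCheck (γ := α - α⁻¹) ?_ h2 hγ0 ?_ hH ?_ (k := k) ?_ hk0
    (hC.hasMinDist hδ hδα hn hZ hlt) (hC.le_span_hammingNorm_eq hδ hδα hn hZ)
  · rw [Nat.card_eq_fintype_card, hF]
  · rw [star_sub, star_inv₀, hαq, inv_inv, neg_sub]
  · rw [hHH, hC.rank_mul_conjTransposeQ_of_card hF hq hδ hδα hn dvd_rfl hH]
  · omega

end Frobenius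

/-! ### The defining set `Z` -/

section CyclotomicCosets

/-- The residue `s + r j` modulo `r n`, where `r = q + 1` and `s = 5 n`. -/
def centeredExponent (q n : ℕ) (j : ℤ) : ZMod ((q + 1) * n) :=
  5 * n + (q + 1) * j

/-- The exponents `s + r j` with `|j| ≤ b`. This is the union of the cosets of `s - r j` for
`0 ≤ j ≤ b`, since multiplication by `q ^ 2` sends `s + r j` to `s - r j`. -/
def symmetricSet (q n b : ℕ) : Set (ZMod ((q + 1) * n)) :=
  centeredExponent q n '' {j | j.natAbs ≤ b}

theorem centeredExponent_eq_iff {q n : ℕ} {i j : ℤ} :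
    centeredExponent q n i = centeredExponent q n j ↔ (n : ℤ) ∣ j - i := by
  have hcast (j : ℤ) : centeredExponent q n j = ((5 * n + (q + 1) * j : ℤ) : ZMod _) := by
    simp [centeredExponent]
  have hsub : (5 * n + (q + 1) * j : ℤ) - (5 * n + (q + 1) * i) = (q + 1) * (j - i) := by ring
  rw [hcast, hcast, ZMod.intCast_eq_intCast_iff_dvd_sub, hsub, Nat.cast_mul, Nat.cast_add_one]
  exact mul_dvd_mul_iff_left (by positivity)

theorem injOn_centeredExponent {q n b : ℕ} (hb : 2 * b < n) :
    Set.InjOn (centeredExponent q n) {j | j.natAbs ≤ b} := by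
  intro i hi j hj hij
  simp only [Set.mem_ofPred_eq] at hi hj
  have := Int.eq_zero_of_abs_lt_dvd (centeredExponent_eq_iff.1 hij) (by rw [abs_lt]; omega)
  omega

theorem ncard_symmetricSet {q n b : ℕ} (hb : 2 * b < n) :
    (symmetricSet q n b).ncard = 2 * b + 1 := by
  have hIcc : {j : ℤ | j.natAbs ≤ b} = Finset.Icc (-b : ℤ) b := by
    ext j
    simp only [Set.mem_ofPred_eq, Finset.coe_Icc, Set.mem_Icc]
    omega
  rw [symmetricSet, (injOn_centeredExponent hb).ncard_image, hIcc, Set.ncard_coe_finset,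
    Int.card_Icc]
  omega

theorem centeredExponent_neg_add_mem_symmetricSet {q n b j : ℕ} (hj : j < 2 * b + 1) :
    centeredExponent q n (-b) + (q + 1 : ℕ) * j ∈ symmetricSet q n b := by
  refine ⟨j - b, by rw [Set.mem_ofPred_eq]; omega, ?_⟩
  simp only [centeredExponent]
  push_cast
  ring

theorem iUnion_image_natAbs_eq {q n : ℕ} (b : ℕ) :
    ⋃ j ∈ Finset.Icc 0 b, centeredExponent q n '' {i | i.natAbs = j} = symmetricSet q n b := by
  ext x
  simp [symmetricSet]

theorem neg_mul_centeredExponent {q n : ℕ} (j : ℤ) :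
    -(q : ZMod ((q + 1) * n)) * centeredExponent q n j = centeredExponent q n (-(q * j)) := by
  have hN : ((q : ZMod ((q + 1) * n)) + 1) * n = 0 := by
    exact_mod_cast ZMod.natCast_self ((q + 1) * n)
  simp only [centeredExponent, Int.cast_neg, Int.cast_mul, Int.cast_natCast]
  linear_combination -5 * hN

theorem image_inter_negMul {q n : ℕ} (S : Set ℤ) :
    centeredExponent q n '' S ∩ negMul q ((q + 1) * n) (centeredExponent q n '' S) =
      centeredExponent q n '' {j ∈ S | ∃ i ∈ S, (n : ℤ) ∣ q * i + j} := by
  ext x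
  constructor
  · rintro ⟨⟨j, hj, rfl⟩, _, ⟨i, hi, rfl⟩, hij⟩
    rw [neg_mul_centeredExponent, centeredExponent_eq_iff] at hij
    exact ⟨j, ⟨hj, i, hi, by rwa [neg_sub_left, dvd_neg, add_comm] at hij⟩, rfl⟩
  · rintro ⟨j, ⟨hj, i, hi, hij⟩, rfl⟩
    refine ⟨⟨j, hj, rfl⟩, _, ⟨i, hi, rfl⟩, ?_⟩
    rwa [neg_mul_centeredExponent, centeredExponent_eq_iff, neg_sub_left, dvd_neg, add_comm]

variable {q n : ℕ} (hn : 10 * n = q ^ 2 + 1)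
include hn

theorem sq_mul_centeredExponent (j : ℤ) :
    (q : ZMod ((q + 1) * n)) ^ 2 * centeredExponent q n j = centeredExponent q n (-j) := by
  have hN : ((q : ZMod ((q + 1) * n)) + 1) * n = 0 := by
    exact_mod_cast ZMod.natCast_self ((q + 1) * n)
  have hn' : (10 * n : ZMod ((q + 1) * n)) = q ^ 2 + 1 := by exact_mod_cast congrArg Nat.cast hn
  simp only [centeredExponent, Int.cast_neg]
  linear_combination (5 * (q - 1) + 10 * j) * hN - (q + 1) * j * hn'

theorem centeredExponent_mem_rootExponents [NeZero ((q + 1) * n)] (j : ℤ) :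
    centeredExponent q n j ∈ rootExponents (q + 1) n := by
  obtain ⟨t, rfl⟩ : ∃ t, q = 2 * t + 1 := by
    refine Nat.not_even_iff_odd.1 fun ⟨t, ht⟩ => ?_
    rw [ht] at hn
    ring_nf at hn
    omega
  have hN : ((2 * t + 1 : ZMod ((2 * t + 1 + 1) * n)) + 1) * n = 0 := by
    exact_mod_cast ZMod.natCast_self ((2 * t + 1 + 1) * n)
  have hn' : (5 * n : ZMod ((2 * t + 1 + 1) * n)) = 2 * t ^ 2 + 2 * t + 1 := by
    have : 5 * n = 2 * t ^ 2 + 2 * t + 1 := by ring_nf at hn; omega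
    exact_mod_cast congrArg Nat.cast this
  rw [mem_rootExponents_iff, centeredExponent]
  push_cast
  linear_combination n * hn' + (j + t) * hN

theorem cyclotomicCoset_centeredExponent (j : ℤ) :
    cyclotomicCoset q ((q + 1) * n) (centeredExponent q n j) =
      centeredExponent q n '' {i | i.natAbs = j.natAbs} := by
  ext x
  simp only [Set.mem_image, Set.mem_ofPred_eq, Int.natAbs_eq_natAbs_iff]
  constructor
  · rintro ⟨t, rfl⟩
    induction t with
    | zero => exact ⟨j, .inl rfl, by simp⟩
    | succ t ih =>
      obtain ⟨i, hi, hx⟩ := ih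
      refine ⟨-i, by omega, ?_⟩
      rw [← sq_mul_centeredExponent hn, hx]
      ring
  · rintro ⟨i, rfl | rfl, rfl⟩
    · exact ⟨0, by simp⟩
    · exact ⟨1, by rw [pow_one, ← sq_mul_centeredExponent hn, mul_comm (centeredExponent q n j)]⟩

theorem cyclotomicCoset_sub_mul (j : ℕ) :
    cyclotomicCoset q ((q + 1) * n) ((5 * n : ℕ) - (q + 1 : ℕ) * j) =
      centeredExponent q n '' {i | i.natAbs = j} := by
  have hj : ((5 * n : ℕ) - (q + 1 : ℕ) * j : ZMod ((q + 1) * n)) = centeredExponent q n (-j) := by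
    simp [centeredExponent, sub_eq_add_neg]
  rw [hj, cyclotomicCoset_centeredExponent hn, Int.natAbs_neg, Int.natAbs_natCast]

theorem natCast_sq_mul_mem_symmetricSet {b : ℕ} :
    ∀ x ∈ symmetricSet q n b,
      ((q ^ 2 : ℕ) : ZMod ((q + 1) * n)) * x ∈ symmetricSet q n b := by
  rintro _ ⟨j, hj, rfl⟩
  rw [Nat.cast_pow, sq_mul_centeredExponent hn]
  exact ⟨-j, by rwa [Set.mem_ofPred_eq, Int.natAbs_neg], rfl⟩

variable {m l : ℕ} (hq : q = 10 * m + 3) (hl : 1 ≤ l) (hlm : l ≤ m)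
include hq hl hlm

theorem exists_dvd_mul_add_iff {j : ℤ} (hj : j.natAbs ≤ 3 * m + l) :
    (∃ i : ℤ, i.natAbs ≤ 3 * m + l ∧ (n : ℤ) ∣ q * i + j) ↔
      j.natAbs = 0 ∨ j.natAbs = 3 * m + 1 ∨ j.natAbs = m := by
  have hqm : (q : ℤ) = 10 * m + 3 := by exact_mod_cast hq
  have hnm : (n : ℤ) = 10 * m ^ 2 + 6 * m + 1 := by
    have : (10 * n : ℤ) = q ^ 2 + 1 := by exact_mod_cast hn
    rw [hqm] at this
    linarith
  rw [hqm, hnm]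
  constructor
  · rintro ⟨i, hi, t, ht⟩
    have hi' : i ≤ 4 * m ∧ -(4 * m) ≤ i := by omega
    have hj' : j ≤ 4 * m ∧ -(4 * m) ≤ j := by omega
    have hm : (1 : ℤ) ≤ m := by omega
    have ht' : -3 ≤ t ∧ t ≤ 3 := by
      constructor <;> by_contra! h <;> nlinarith
    -- Since `n = q m + (3 m + 1)`, the bounds on `t` and `j` put `i` within 1 of `t m`.
    obtain ⟨u, rfl⟩ : ∃ u, i = t * m + u := ⟨i - t * m, by ring⟩
    have hu : j = 3 * t * m + t - (10 * m + 3) * u := by linear_combination ht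
    have hu' : -1 ≤ u ∧ u ≤ 1 := by
      constructor <;> by_contra! h <;> nlinarith
    obtain ⟨ht₁, ht₂⟩ := ht'
    obtain ⟨hu₁, hu₂⟩ := hu'
    interval_cases t <;> interval_cases u <;> omega
  · intro h
    obtain rfl | rfl | rfl | rfl | rfl : j = 0 ∨ j = 3 * m + 1 ∨ j = -(3 * m + 1) ∨ j = m ∨
      j = -m := by omega
    · exact ⟨0, by omega, 0, by ring⟩
    · exact ⟨m, by omega, 1, by ring⟩
    · exact ⟨-m, by omega, -1, by ring⟩
    · exact ⟨-(3 * m + 1), by omega, -3, by ring⟩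
    · exact ⟨3 * m + 1, by omega, 3, by ring⟩

theorem symmetricSet_inter_negMul :
    symmetricSet q n (3 * m + l) ∩ negMul q ((q + 1) * n) (symmetricSet q n (3 * m + l)) =
    centeredExponent q n '' {j | j.natAbs = 0} ∪
      centeredExponent q n '' {j | j.natAbs = 3 * m + 1} ∪
      centeredExponent q n '' {j | j.natAbs = m} := by
  rw [symmetricSet, image_inter_negMul, ← Set.image_union, ← Set.image_union]
  congr 1
  ext j
  simp only [Set.mem_ofPred_eq, Set.mem_union, or_assoc]
  constructor
  · rintro ⟨hj, hij⟩
    exact (exists_dvd_mul_add_iff hn hq hl hlm hj).1 hij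
  · intro h
    have hj : j.natAbs ≤ 3 * m + l := by omega
    exact ⟨hj, (exists_dvd_mul_add_iff hn hq hl hlm hj).2 h⟩

theorem ncard_symmetricSet_inter_negMul (hb : 2 * (3 * m + l) < n) :
    (symmetricSet q n (3 * m + l) ∩
      negMul q ((q + 1) * n) (symmetricSet q n (3 * m + l))).ncard = 5 := by
  have hsub : {j : ℤ | j.natAbs = 0} ∪ {j | j.natAbs = 3 * m + 1} ∪ {j | j.natAbs = m} ⊆
      {j : ℤ | j.natAbs ≤ 3 * m + l} := by
    rintro j ((h | h) | h) <;> simp only [Set.mem_ofPred_eq] at h ⊢ <;> omega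
  have hset : {j : ℤ | j.natAbs = 0} ∪ {j | j.natAbs = 3 * m + 1} ∪ {j | j.natAbs = m} =
      ({0, (3 * m + 1 : ℤ), -(3 * m + 1 : ℤ), (m : ℤ), -(m : ℤ)} : Finset ℤ) := by
    ext j
    simp only [Set.mem_union, Set.mem_ofPred_eq, Finset.coe_insert, Finset.coe_singleton,
      Set.mem_insert_iff, Set.mem_singleton_iff]
    omega
  rw [symmetricSet_inter_negMul hn hq hl hlm, ← Set.image_union, ← Set.image_union,
    ((injOn_centeredExponent hb).mono hsub).ncard_image, hset, Set.ncard_coe_finset]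
  repeat rw [Finset.card_insert_of_notMem (by simp; omega)]
  rw [Finset.card_singleton]

end CyclotomicCosets

section SymmetricCode

variable {F K : Type*} [Field F] [Fintype F] [Field K] [Algebra F K] {q n b : ℕ}
  [NeZero ((q + 1) * n)] {α : F} {δ : K} (hF : Fintype.card F = q ^ 2)
  (hn : 10 * n = q ^ 2 + 1) (hδ : IsPrimitiveRoot δ ((q + 1) * n))
  (hδα : δ ^ n = algebraMap F K α)
include hF hn hδ hδα

theorem exists_isConstacyclicWithDefiningSet_symmetricSet :
    ∃ C : Submodule F (Fin n → F),
      IsConstacyclicWithDefiningSet (q + 1) n δ α C (symmetricSet q n b) :=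
  exists_isConstacyclicWithDefiningSet hδ hδα (natCast_ne_zero_of_dvd hF (Dvd.intro_left _ hn))
    (Set.image_subset_iff.2 fun j _ => centeredExponent_mem_rootExponents hn j)
    (hF ▸ natCast_sq_mul_mem_symmetricSet hn)

variable {C : Submodule F (Fin n → F)} (hb : 2 * b + 1 < n)
  (hC : IsConstacyclicWithDefiningSet (q + 1) n δ α C (symmetricSet q n b))
include hb hC

theorem hasMinDist_of_symmetricSet [DecidableEq F] : HasMinDist C (2 * b + 2) := by
  have hcard : (symmetricSet q n b).ncard = 2 * b + 1 := ncard_symmetricSet (by omega)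
  have hmin := hC.hasMinDist hδ hδα (natCast_ne_zero_of_dvd hF (Dvd.intro_left _ hn))
    (fun j hj => centeredExponent_neg_add_mem_symmetricSet (hcard ▸ hj)) (by omega)
  rwa [hcard] at hmin

theorem finrank_add_of_symmetricSet : Module.finrank F C + (2 * b + 1) = n := by
  rw [← ncard_symmetricSet (q := q) (n := n) (b := b) (by omega)]
  exact hC.finrank_add_ncard hδ hδα (natCast_ne_zero_of_dvd hF (Dvd.intro_left _ hn))

theorem existsEAQECC_of_symmetricSet {c k : ℕ} (hq : IsPrimePow q)
    (hα : IsPrimitiveRoot α (q + 1)) (hk0 : k ≠ 0) (hk : k + 2 * (2 * b + 1) = n + c)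
    (hc : (symmetricSet q n b ∩ negMul q ((q + 1) * n) (symmetricSet q n b)).ncard = c) :
    ExistsEAQECC q n k (2 * b + 2) c := by
  have hcard : (symmetricSet q n b).ncard = 2 * b + 1 := ncard_symmetricSet (by omega)
  have h2 : ((2 : ℕ) : F) ≠ 0 := natCast_ne_zero_of_dvd hF ⟨5 * n, by omega⟩
  have hex := hC.existsEAQECC hF hq (mod_cast h2) hα hδ hδα
    (natCast_ne_zero_of_dvd hF (Dvd.intro_left _ hn))
    (fun j hj => centeredExponent_neg_add_mem_symmetricSet (hcard ▸ hj)) (by omega) hk0 (by omega)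
  rwa [hcard, hc] at hex

end SymmetricCode

section Parameters

theorem dimension_eq {q m n l k : ℕ} (hq : q = 10 * m + 3) (hk : k + 4 * (3 * m + l) = n + 3) :
    (k : ℚ) = n - 6 / 5 * (q - 3) - 4 * l + 3 := by
  have hqQ : (q : ℚ) = 10 * m + 3 := by exact_mod_cast hq
  have hkQ : (k : ℚ) + 4 * (3 * m + l) = n + 3 := by exact_mod_cast hk
  rw [hqQ]
  linarith

theorem distance_eq {q m : ℕ} (hq : q = 10 * m + 3) (l : ℕ) :
    ((2 * (3 * m + l) + 2 : ℕ) : ℚ) = 3 / 5 * (q - 3) + 2 * l + 2 := by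
  rw [hq]
  push_cast
  ring

variable {q m n l : ℕ} (hq : q = 10 * m + 3) (hn : n = (q ^ 2 + 1) / 10)
include hq hn

theorem eq_of_eq_ten_mul_add_three : n = 10 * m ^ 2 + 6 * m + 1 := by
  have hsq : q ^ 2 + 1 = 10 * (10 * m ^ 2 + 6 * m + 1) := by
    rw [hq]
    ring
  omega

theorem ten_mul_eq_sq_add_one : 10 * n = q ^ 2 + 1 := by
  rw [eq_of_eq_ten_mul_add_three hq hn, hq]
  ring

theorem four_mul_lt_add_three (hlm : l ≤ m) : 4 * (3 * m + l) < n + 3 := by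
  have := eq_of_eq_ten_mul_add_three hq hn
  have := Nat.le_self_pow two_ne_zero m
  omega

theorem distance_le (hlm : l ≤ m) (hm : 2 ≤ m) :
    ((2 * (3 * m + l) + 2 : ℕ) : ℚ) ≤ (n + 2) / 2 := by
  have := eq_of_eq_ten_mul_add_three hq hn
  have : 2 * m ≤ m ^ 2 := by
    rw [sq]
    exact Nat.mul_le_mul_right m hm
  rw [le_div_iff₀ two_pos]
  exact_mod_cast (by omega : (2 * (3 * m + l) + 2) * 2 ≤ n + 2)

end Parameters

end EAQ

end

theorem mainTheorem3 {F K : Type*} [Field F] [Fintype F] [DecidableEq F] [Field K] [Algebra F K]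
    (q n r s l : ℕ) (hq : IsPrimePow q) (hq3 : q ≡ 3 [MOD 10])
    (hn : n = (q ^ 2 + 1) / 10) (hr : r = q + 1) (hs : s = (q ^ 2 + 1) / 2)
    (hl : 1 ≤ l) (hl' : l ≤ (q - 3) / 10)
    (hF : Fintype.card F = q ^ 2)
    (α : F) (hα : IsPrimitiveRoot α r)
    (δ : K) (hδ : IsPrimitiveRoot δ (r * n)) (hδα : δ ^ n = algebraMap F K α)
    (coset : ℕ → Set (ZMod (r * n)))
    (hcoset : ∀ j : ℕ, coset j =
      EAQ.cyclotomicCoset q (r * n) ((s : ZMod (r * n)) - (r : ZMod (r * n)) * (j : ZMod (r * n))))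
    (Z : Set (ZMod (r * n))) (hZ : Z = ⋃ j ∈ Finset.Icc 0 (3 * (q - 3) / 10 + l), coset j) :
    Z ∩ EAQ.negMul q (r * n) Z = coset 0 ∪ coset ((3 * q + 1) / 10) ∪ coset ((q - 3) / 10) ∧
    (∃ C : Submodule F (Fin n → F), EAQ.IsConstacyclicWithDefiningSet r n δ α C Z) ∧
    ∃ k d : ℕ,
      (k : ℚ) = (n : ℚ) - 6 / 5 * ((q : ℚ) - 3) - 4 * (l : ℚ) + 3 ∧
      (d : ℚ) = 3 / 5 * ((q : ℚ) - 3) + 2 * (l : ℚ) + 2 ∧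
      (∀ C : Submodule F (Fin n → F), EAQ.IsConstacyclicWithDefiningSet r n δ α C Z →
        EAQ.HasMinDist C d ∧
        (k : ℤ) = 2 * (Module.finrank F C : ℤ) - (n : ℤ) + 5 ∧
        ∀ (m : ℕ) (H : Matrix (Fin m) (Fin n) F), EAQ.IsParityCheck H C →
          (H * EAQ.conjTransposeQ q H).rank = 5) ∧
      EAQ.ExistsEAQECC q n k d 5 ∧
      (n : ℤ) + 5 - (k : ℤ) = 2 * ((d : ℤ) - 1) ∧
      (q ≠ 13 → (d : ℚ) ≤ ((n : ℚ) + 2) / 2) := by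
  obtain ⟨m, hm⟩ : ∃ m, q = 10 * m + 3 := ⟨q / 10, by have : q % 10 = 3 := hq3; omega⟩
  have hlm : l ≤ m := by omega
  have hn10 := EAQ.ten_mul_eq_sq_add_one hm hn
  have hbn := EAQ.four_mul_lt_add_three hm hn hlm
  obtain ⟨k, hk⟩ : ∃ k, k + 4 * (3 * m + l) = n + 3 := ⟨n + 3 - 4 * (3 * m + l), by omega⟩
  obtain rfl : s = 5 * n := by omega
  subst hr
  have : NeZero ((q + 1) * n) := ⟨mul_ne_zero q.succ_ne_zero (by omega)⟩
  simp only [EAQ.cyclotomicCoset_sub_mul hn10] at hcoset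
  obtain rfl : Z = EAQ.symmetricSet q n (3 * m + l) := by
    rw [hZ, show 3 * (q - 3) / 10 = 3 * m by omega, ← EAQ.iUnion_image_natAbs_eq]
    simp only [hcoset]
  have hZ5 := EAQ.ncard_symmetricSet_inter_negMul hn10 hm hl hlm (by omega)
  have hnF : (n : F) ≠ 0 := EAQ.natCast_ne_zero_of_dvd hF (Dvd.intro_left _ hn10)
  obtain ⟨C, hC⟩ := EAQ.exists_isConstacyclicWithDefiningSet_symmetricSet hF hn10 hδ hδα
  refine ⟨?_, ⟨C, hC⟩, k, _, EAQ.dimension_eq hm hk, EAQ.distance_eq hm l,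
    fun C' hC' => ⟨?_, ?_, fun _ H hH => ?_⟩, ?_, by omega,
    fun hq13 => EAQ.distance_le hm hn hlm (by omega)⟩
  · rw [hcoset, hcoset, hcoset, show (3 * q + 1) / 10 = 3 * m + 1 by omega,
      show (q - 3) / 10 = m by omega, EAQ.symmetricSet_inter_negMul hn10 hm hl hlm]
  · exact EAQ.hasMinDist_of_symmetricSet hF hn10 hδ hδα (by omega) hC'
  · have := EAQ.finrank_add_of_symmetricSet hF hn10 hδ hδα (by omega) hC'
    omega
  · rw [hC'.rank_mul_conjTransposeQ_of_card hF hq hδ hδα hnF dvd_rfl hH, hZ5]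
  · exact EAQ.existsEAQECC_of_symmetricSet hF hn10 hδ hδα (by omega) hC hq hα (by omega)
      (by omega) hZ5
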